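/- Let $Q=\{(\boldsymbol R_1,\boldsymbol R_2)\in S^2\times S^2:\boldsymbol R_1\neq\pm \boldsymbol R_2\}$, where $S^2\subset\mathbb R^3$ is the unit sphere, let $T^*Q$ carry its canonical Poisson bracket (with $\{x^i,\xi_j\}=\delta^i_j$ in cotangent coordinates), and let $SO(3)$ act on $T^*Q$ by the cotangent lift of the simultaneous rotation of both points. (1) On $P=\mathbb R^3\times(0,\pi)\times\mathbb R\ni(\boldsymbol m,q,p)$, $\boldsymbol m=(m_x,m_y,m_z)$, the formula $$\{F,G\}_P=-\Big(\boldsymbol m,\tfrac{\partial F}{\partial \boldsymbol m}\times\tfrac{\partial G}{\partial \boldsymbol m}\Big)+\tfrac{\partial F}{\partial q}\tfrac{\partial G}{\partial p}-\tfrac{\partial F}{\partial p}\tfrac{\partial G}{\partial q}$$ defines a Poisson bracket, with $\{m_x,m_y\}=-m_z$, $\{m_y,m_z\}=-m_x$, $\{m_z,m_x\}=-m_y$, $\{q,p\}=1$, all other brackets of coordinates being zero, and $|\boldsymbol m|^2$ is a Casimir function. (2) The orbit space $T^*Q/SO(3)$, with the quotient topology, has a smooth manifold structure and a Poisson bracket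 for which the projection $\pi:T^*Q\to T^*Q/SO(3)$ is a smooth submersion and a Poisson map, and there is a Poisson diffeomorphism $\Psi:T^*Q/SO(3)\to P$. It can be chosen as follows. For $\alpha\in T^*_{(\boldsymbol R_1,\boldsymbol R_2)}Q$ write $\Psi(\pi(\alpha))=(\boldsymbol m,q,p)$, and let $(e_x,e_y,e_z)$ be the positively oriented orthonormal frame with $e_z=\boldsymbol R_1$ and $\boldsymbol R_2=\sin q\,e_y+\cos q\,e_z$. Then $q$ is the angle between $\boldsymbol R_1$ and $\boldsymbol R_2$, the vector $\boldsymbol m$ is the angular momentum in this frame, i.e. $\alpha(\xi\times \boldsymbol R_1,\xi\times \boldsymbol R_2)=m_x(e_x,\xi)+m_y(e_y,\xi)+m_z(e_z,\xi)$ for all $\xi\in\mathbb R^3$, and $p=\alpha(0,\cos q\,e_y-\sin q\,e_z)$. (3) With the same $\Psi$, for all masses $\mu_1,\mu_2>0$ and every potential $U:(0,\pi)\to\mathbb R$, let $H=T+U(q)$ on $T^*Q$, where $T$ is the kinetic energy $\frac12(\mu_1\|\dot{\boldsymbol R}_1\|^2+\mu_2\|\dot{\boldsymbol R}_2\|^2)$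 expressed through momenta by the Legendre transformation. Then $H=H_P\circ\Psi\circ\pi$ with $$H_P(\boldsymbol m,q,p)=\frac1{2\mu_1}\Big((\boldsymbol m,\mathbf A(q)\boldsymbol m)+2m_xp+(1+\mu)p^2\Big)+U(q),\qquad \mathbf A(q)=\begin{pmatrix}1&0&0\\0&1&\frac{\cos q}{\sin q}\\0&\frac{\cos q}{\sin q}&\frac{\mu+\cos^2q}{\sin^2q}\end{pmatrix},\quad \mu=\frac{\mu_1}{\mu_2}.$$ If $U$ is differentiable, then the reduced dynamics is Hamiltonian with Hamiltonian $H_P$: for every smooth $F$ on $P$ one has $\{F\circ\Psi\circ\pi,H\}=\{F,H_P\}_P\circ\Psi\circ\pi$, and $\Psi\circ\pi$ maps the trajectories of $H$ on $T^*Q$ to trajectories of $H_P$ on $P$. -/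

import Mathlib

open Set Manifold Bundle
open scoped ContDiff InnerProductSpace Matrix

noncomputable section

namespace TwoBody

/-! ### Cotangent bundles and their canonical Poisson bracket -/

section General

variable {E : Type*} [NormedAddCommGroup E] [NormedSpace ℝ E]
  {H : Type*} [TopologicalSpace H] (I : ModelWithCorners ℝ E H)
  (M : Type*) [TopologicalSpace M] [ChartedSpace H M]

/-- The fibre `T*_x M` of the cotangent bundle. -/
abbrev CotangentSpace (x : M) : Type _ := TangentSpace I x →L[ℝ] Bundle.Trivial M ℝ x

/-- The total space `T*M` of the cotangent bundle; its smooth structure is Mathlib's one on the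
bundle of continuous linear maps from the tangent bundle to the trivial line bundle. -/
abbrev CotangentBundle : Type _ := TotalSpace (E →L[ℝ] ℝ) (CotangentSpace I M)

/-- The model with corners of `T*M`. -/
abbrev cotangentModel : ModelWithCorners ℝ (E × (E →L[ℝ] ℝ)) (ModelProd H (E →L[ℝ] ℝ)) :=
  I.prod 𝓘(ℝ, E →L[ℝ] ℝ)

variable {M} [IsManifold I ∞ M]

/-- The canonical Poisson bracket on `T*M`,
`{f, h} = ∑ i, (∂f/∂xⁱ ∂h/∂ξᵢ - ∂h/∂xⁱ ∂f/∂ξᵢ)`.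
The differential at `z` of a function on `T*M` is expressed by `mfderiv` in the preferred chart of
`T*M` at `z`. That chart is the cotangent lift of the preferred chart of `M` at the base point of
`z`, so its coordinates `(x, ξ) ∈ E × E*` are canonical ones. The sum runs over a basis of `E` and
its dual basis. -/
def canonicalBracket [FiniteDimensional ℝ E] (f h : CotangentBundle I M → ℝ)
    (z : CotangentBundle I M) : ℝ :=
  let df : E × (E →L[ℝ] ℝ) →L[ℝ] ℝ := mfderiv (cotangentModel I) 𝓘(ℝ, ℝ) f z
  let dh : E × (E →L[ℝ] ℝ) →L[ℝ] ℝ := mfderiv (cotangentModel I) 𝓘(ℝ, ℝ) h z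
  let b := Module.finBasis ℝ E
  ∑ i, (df (b i, 0) * dh (0, LinearMap.toContinuousLinearMap (b.coord i))
    - dh (b i, 0) * df (0, LinearMap.toContinuousLinearMap (b.coord i)))

end General

/-! ### Poisson brackets, Poisson maps, Hamiltonian trajectories -/

section Poisson

variable {E : Type*} [NormedAddCommGroup E] [NormedSpace ℝ E]
  {H : Type*} [TopologicalSpace H] (I : ModelWithCorners ℝ E H)
  {M : Type*} [TopologicalSpace M] [ChartedSpace H M]
  {E' : Type*} [NormedAddCommGroup E'] [NormedSpace ℝ E']
  {H' : Type*} [TopologicalSpace H'] (I' : ModelWithCorners ℝ E' H')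
  {M' : Type*} [TopologicalSpace M'] [ChartedSpace H' M']

/-- `f` is a smooth real function. -/
abbrev SmoothFun (f : M → ℝ) : Prop := ContMDiff I 𝓘(ℝ, ℝ) ∞ f

/-- `br` is a Poisson bracket on the smooth functions of the manifold `M`. (Its values on other
functions are irrelevant.) -/
structure IsPoissonBracket (br : (M → ℝ) → (M → ℝ) → (M → ℝ)) : Prop where
  smooth : ∀ f h, SmoothFun I f → SmoothFun I h → SmoothFun I (br f h)
  skew : ∀ f h, SmoothFun I f → SmoothFun I h → br f h = -br h f
  add_left : ∀ f₁ f₂ h, SmoothFun I f₁ → SmoothFun I f₂ → SmoothFun I h →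
    br (f₁ + f₂) h = br f₁ h + br f₂ h
  smul_left : ∀ (c : ℝ) f h, SmoothFun I f → SmoothFun I h → br (c • f) h = c • br f h
  leibniz : ∀ f₁ f₂ h, SmoothFun I f₁ → SmoothFun I f₂ → SmoothFun I h →
    br (f₁ * f₂) h = f₁ * br f₂ h + f₂ * br f₁ h
  jacobi : ∀ f₁ f₂ f₃, SmoothFun I f₁ → SmoothFun I f₂ → SmoothFun I f₃ →
    br f₁ (br f₂ f₃) + br f₂ (br f₃ f₁) + br f₃ (br f₁ f₂) = 0

/-- The smooth map `φ` intertwines the brackets `br` on `M` and `br'` on `M'`. -/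
def IsPoissonMap (br : (M → ℝ) → (M → ℝ) → (M → ℝ)) (br' : (M' → ℝ) → (M' → ℝ) → (M' → ℝ))
    (φ : M → M') : Prop :=
  ContMDiff I I' ∞ φ ∧ ∀ f h : M' → ℝ, SmoothFun I' f → SmoothFun I' h →
    ∀ z, br (f ∘ φ) (h ∘ φ) z = br' f h (φ z)

/-- `c` is a smooth function that commutes with all smooth functions. -/
def IsCasimir (br : (M → ℝ) → (M → ℝ) → (M → ℝ)) (c : M → ℝ) : Prop :=
  SmoothFun I c ∧ ∀ f, SmoothFun I f → br c f = 0

/-- `γ : J → M` follows the Hamiltonian dynamics of `h`: `d/dt f(γ(t)) = {f, h}(γ(t))` for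
every smooth function `f`. -/
def IsHamiltonianTrajectory (br : (M → ℝ) → (M → ℝ) → (M → ℝ)) (h : M → ℝ) (J : Set ℝ)
    (γ : ℝ → M) : Prop :=
  ∀ t ∈ J, ∀ f, SmoothFun I f → HasDerivWithinAt (f ∘ γ) (br f h (γ t)) J t

/-- A smooth map whose differential is surjective at every point. -/
def IsSmoothSubmersion (φ : M → M') : Prop :=
  ContMDiff I I' ∞ φ ∧ ∀ z, Function.Surjective (mfderiv I I' φ z)

end Poisson

/-! ### Configuration and phase space of two bodies on the sphere -/

/-- Euclidean three-space. -/
abbrev E3 : Type := EuclideanSpace ℝ (Fin 3)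

/-- The vector product in `ℝ³`. -/
def cross (a b : E3) : E3 := WithLp.toLp 2 (a.ofLp ⨯₃ b.ofLp)

instance : Fact (Module.finrank ℝ E3 = 2 + 1) := ⟨by simp⟩

/-- The unit sphere in `ℝ³`. -/
abbrev S2 : Type := Metric.sphere (0 : E3) 1

/-- Pairs of points of the sphere that are neither equal nor antipodal, as an open submanifold
of `S² × S²`. -/
def configOpens : TopologicalSpace.Opens (S2 × S2) where
  carrier := {x | (x.1 : E3) ≠ x.2 ∧ (x.1 : E3) ≠ -(x.2 : E3)}
  is_open' := by
    apply IsOpen.inter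
    · exact isOpen_ne_fun (by fun_prop) (by fun_prop)
    · exact isOpen_ne_fun (by fun_prop) (by fun_prop)

/-- The configuration manifold `Q`. -/
abbrev Q : Type := configOpens

/-- The model with corners of `Q`. -/
abbrev modelQ := (𝓡 2).prod (𝓡 2)

/-- The model vector space of `Q`, to which all its tangent spaces reduce. -/
abbrev ModelSpace : Type := EuclideanSpace ℝ (Fin 2) × EuclideanSpace ℝ (Fin 2)

/-- The phase space `T*Q`. -/
abbrev TStarQ : Type := CotangentBundle modelQ Q

/-- The model with corners of `T*Q`. -/
abbrev modelTStarQ := cotangentModel modelQ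

/-- Position of the first body. -/
def R₁ (x : Q) : E3 := x.1.1

/-- Position of the second body. -/
def R₂ (x : Q) : E3 := x.1.2

/-- The velocities `(Ṙ₁, Ṙ₂)` in `ℝ³ × ℝ³` of a tangent vector at `x`: the differential of the
inclusion of `Q` into `ℝ³ × ℝ³`. -/
def velocity (x : Q) : TangentSpace modelQ x →L[ℝ] E3 × E3 :=
  mfderiv modelQ 𝓘(ℝ, E3 × E3) (fun y : Q => (R₁ y, R₂ y)) x

/-! ### The action of `SO(3)` -/

/-- The rotation group `SO(3)`. -/
abbrev SO3 : Type := Matrix.specialOrthogonalGroup (Fin 3) ℝ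

/-- Rotation of a vector. -/
def rot (g : SO3) (v : E3) : E3 := Matrix.toEuclideanLin (g : Matrix (Fin 3) (Fin 3) ℝ) v

theorem rot_one (v : E3) : rot 1 v = v := by
  ext i; simp [rot, Matrix.toEuclideanLin]

theorem rot_mul (g h : SO3) (v : E3) : rot (g * h) v = rot g (rot h v) := by
  ext i; simp [rot, Matrix.toEuclideanLin]

theorem norm_rot (g : SO3) (v : E3) : ‖rot g v‖ = ‖v‖ := by
  have hg : ((g : Matrix (Fin 3) (Fin 3) ℝ))ᵀ * (g : Matrix (Fin 3) (Fin 3) ℝ) = 1 := by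
    have := (Matrix.mem_specialOrthogonalGroup_iff.1 g.2).1
    exact (Matrix.mem_orthogonalGroup_iff' _ _).1 this
  have h : inner ℝ (rot g v) (rot g v) = inner ℝ v v := by
    simp only [rot, EuclideanSpace.inner_eq_star_dotProduct, star_trivial,
      Matrix.toEuclideanLin, Matrix.toLpLin_apply]
    rw [Matrix.dotProduct_mulVec, Matrix.vecMul_mulVec, hg]
    simp
  rw [real_inner_self_eq_norm_sq, real_inner_self_eq_norm_sq] at h
  exact (sq_eq_sq₀ (norm_nonneg _) (norm_nonneg _)).1 h

theorem rot_injective (g : SO3) : Function.Injective (rot g) := fun v w h => by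
  have := congrArg (rot g⁻¹) h
  simpa [← rot_mul, rot_one] using this

theorem rot_neg (g : SO3) (v : E3) : rot g (-v) = -rot g v := by simp [rot]

/-- `SO(3)` rotates both bodies simultaneously. -/
instance instSMulQ : SMul SO3 Q where
  smul g x := ⟨(⟨rot g (R₁ x), by simp [norm_rot, R₁]⟩, ⟨rot g (R₂ x), by simp [norm_rot, R₂]⟩),
    ⟨fun h => x.2.1 (rot_injective g h),
      fun h => x.2.2 (rot_injective g (h.trans (rot_neg g _).symm))⟩⟩

instance instMulActionQ : MulAction SO3 Q where
  one_smul x := by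
    apply Subtype.ext; apply Prod.ext <;> apply Subtype.ext
    · exact rot_one _
    · exact rot_one _
  mul_smul g h x := by
    apply Subtype.ext; apply Prod.ext <;> apply Subtype.ext
    · exact rot_mul g h _
    · exact rot_mul g h _

theorem R₁_smul (g : SO3) (x : Q) : R₁ (g • x) = rot g (R₁ x) := rfl

theorem R₂_smul (g : SO3) (x : Q) : R₂ (g • x) = rot g (R₂ x) := rfl

theorem contDiff_rot (g : SO3) : ContDiff ℝ ∞ (rot g) :=
  (LinearMap.toContinuousLinearMap
    (Matrix.toEuclideanLin (g : Matrix (Fin 3) (Fin 3) ℝ))).contDiff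

theorem contMDiff_R₁ : ContMDiff modelQ 𝓘(ℝ, E3) ∞ R₁ :=
  contMDiff_coe_sphere.comp (contMDiff_fst.comp contMDiff_subtype_val)

theorem contMDiff_R₂ : ContMDiff modelQ 𝓘(ℝ, E3) ∞ R₂ :=
  contMDiff_coe_sphere.comp (contMDiff_snd.comp contMDiff_subtype_val)

/-- A map into an open submanifold is smooth if it is smooth into the ambient manifold. -/
theorem contMDiff_of_val {N : Type*} [TopologicalSpace N] {H : Type*} [TopologicalSpace H]
    {E : Type*} [NormedAddCommGroup E] [NormedSpace ℝ E] {I : ModelWithCorners ℝ E H}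
    [ChartedSpace H N] {f : N → Q}
    (hf : ContMDiff I modelQ ∞ (fun y => (f y : S2 × S2))) : ContMDiff I modelQ ∞ f := by
  intro y
  rw [contMDiffAt_iff_target]
  exact ⟨(Topology.IsInducing.subtypeVal.continuous_iff.2 hf.continuous).continuousAt,
    (contMDiffAt_iff_target.1 (hf y)).2⟩

theorem contMDiff_smul (g : SO3) : ContMDiff modelQ modelQ ∞ (fun x : Q => g • x) := by
  apply contMDiff_of_val
  apply ContMDiff.prodMk
  · exact ContMDiff.codRestrict_sphere
      ((contDiff_rot g).contMDiff.comp contMDiff_R₁) _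
  · exact ContMDiff.codRestrict_sphere
      ((contDiff_rot g).contMDiff.comp contMDiff_R₂) _

/-- The differential of the rotation `x ↦ g • x` of `Q`. -/
def dSmul (g : SO3) (x : Q) : TangentSpace modelQ x →L[ℝ] TangentSpace modelQ (g • x) :=
  mfderiv modelQ modelQ (fun y : Q => g • y) x

theorem hasMFDerivAt_smul (g : SO3) (x : Q) :
    HasMFDerivAt modelQ modelQ (fun y : Q => g • y) x (dSmul g x) :=
  ((contMDiff_smul g).mdifferentiable (by simp) x).hasMFDerivAt

theorem mfderiv_eq_of_eq {f f' : Q → Q} (e : f = f') (x : Q) (L : ModelSpace →L[ℝ] ModelSpace)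
    (h : HasMFDerivAt modelQ modelQ f' x L) :
    (mfderiv modelQ modelQ f x : ModelSpace →L[ℝ] ModelSpace) = L := by
  subst e; exact h.mfderiv

/-- `dSmul` as an endomorphism of the model vector space, which is what tangent spaces unfold to. -/
def dSmulModel (g : SO3) (x : Q) : ModelSpace →L[ℝ] ModelSpace := dSmul g x

theorem dSmul_one (x : Q) : dSmulModel 1 x = ContinuousLinearMap.id ℝ ModelSpace :=
  mfderiv_eq_of_eq (funext fun y => one_smul SO3 y) x _ (hasMFDerivAt_id x)

theorem dSmul_mul (g h : SO3) (x : Q) :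
    dSmulModel (g * h) x = (dSmulModel g (h • x)).comp (dSmulModel h x) :=
  mfderiv_eq_of_eq (f' := (fun y : Q => g • y) ∘ (fun y : Q => h • y))
    (funext fun y => mul_smul g h y) x _
    ((hasMFDerivAt_smul g (h • x)).comp x (hasMFDerivAt_smul h x))

theorem dSmul_isInvertible (g : SO3) (x : Q) : (dSmulModel g x).IsInvertible := by
  have hA : (dSmulModel g⁻¹ (g • x)).comp (dSmulModel g x) =
      ContinuousLinearMap.id ℝ ModelSpace := by
    rw [← dSmul_mul, inv_mul_cancel, dSmul_one]
  have hB : (dSmulModel g x).comp (dSmulModel g⁻¹ (g • x)) =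
      ContinuousLinearMap.id ℝ ModelSpace := by
    have h := dSmul_mul g g⁻¹ (g • x)
    rw [inv_smul_smul, mul_inv_cancel, dSmul_one] at h
    exact h.symm
  exact ContinuousLinearMap.IsInvertible.of_inverse hB hA

/-- The cotangent lift of the rotation by `g`: the covector `α` at `x` goes to the covector
`α ∘ (d(g • ·)ₓ)⁻¹` at `g • x`. -/
instance instSMulTStarQ : SMul SO3 TStarQ where
  smul g z := ⟨g • z.proj, z.2.comp (dSmul g z.proj).inverse⟩

theorem mk_inverse_one {x y : Q} (h : y = x) (α A) (hA : A = ContinuousLinearMap.id ℝ ModelSpace) :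
    (⟨y, (α : ModelSpace →L[ℝ] ℝ).comp A.inverse⟩ : TStarQ) = ⟨x, α⟩ := by
  subst h hA; rw [ContinuousLinearMap.inverse_id]; rfl

theorem mk_inverse_mul {x y : Q} (h : y = x) (α A) {B C : ModelSpace →L[ℝ] ModelSpace}
    (hB : B.IsInvertible) (hA : A = B.comp C) :
    (⟨y, (α : ModelSpace →L[ℝ] ℝ).comp A.inverse⟩ : TStarQ)
      = ⟨x, (α.comp C.inverse).comp B.inverse⟩ := by
  subst h hA; rw [hB.inverse_comp_of_left]; rfl

instance instMulActionTStarQ : MulAction SO3 TStarQ where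
  one_smul z := mk_inverse_one (one_smul SO3 z.proj) z.2 (dSmulModel 1 z.proj) (dSmul_one z.proj)
  mul_smul g h z := mk_inverse_mul (mul_smul g h z.proj) z.2 (dSmulModel (g * h) z.proj)
    (dSmul_isInvertible g (h • z.proj)) (dSmul_mul g h z.proj)

/-- The reduced space `T*Q / SO(3)`, with the quotient topology. -/
abbrev OrbitSpace : Type := MulAction.orbitRel.Quotient SO3 TStarQ

/-- The projection `T*Q → T*Q / SO(3)`. -/
def orbitProj (z : TStarQ) : OrbitSpace := Quotient.mk _ z

/-! ### The Hamiltonian on `T*Q` -/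

/-- The angle `q ∈ (0, π)` subtended by the bodies. -/
def angleQ (x : Q) : ℝ := InnerProductGeometry.angle (R₁ x) (R₂ x)

/-- The kinetic energy `½ (μ₁ ‖Ṙ₁‖² + μ₂ ‖Ṙ₂‖²)` of a tangent vector. -/
def kineticEnergy (μ₁ μ₂ : ℝ) (x : Q) (v : TangentSpace modelQ x) : ℝ :=
  (μ₁ * ‖(velocity x v).1‖ ^ 2 + μ₂ * ‖(velocity x v).2‖ ^ 2) / 2

/-- `α = ∂T/∂v`, that is `α = μ₁ ⟪Ṙ₁, ·⟫ + μ₂ ⟪Ṙ₂, ·⟫`: the covector `α` is the momentum of the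
tangent vector `v`. -/
def IsMomentumOf (μ₁ μ₂ : ℝ) (x : Q) (α : CotangentSpace modelQ Q x) (v : TangentSpace modelQ x) :
    Prop :=
  ∀ w, (α w : ℝ) = μ₁ * ⟪(velocity x v).1, (velocity x w).1⟫_ℝ
    + μ₂ * ⟪(velocity x v).2, (velocity x w).2⟫_ℝ

/-- The kinetic energy as a function on `T*Q`, the Legendre transform of the kinetic energy on
tangent vectors. It assigns to the momentum of `v` the kinetic energy of `v`; see
`cotangentKineticEnergy_eq`. -/
def cotangentKineticEnergy (μ₁ μ₂ : ℝ) (z : TStarQ) : ℝ :=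
  ⨆ v : TangentSpace modelQ z.proj, ((z.2 v : ℝ) - kineticEnergy μ₁ μ₂ z.proj v)

theorem cotangentKineticEnergy_eq {μ₁ μ₂ : ℝ} (h₁ : 0 < μ₁) (h₂ : 0 < μ₂) (z : TStarQ)
    (v : TangentSpace modelQ z.proj) (hv : IsMomentumOf μ₁ μ₂ z.proj z.2 v) :
    cotangentKineticEnergy μ₁ μ₂ z = kineticEnergy μ₁ μ₂ z.proj v := by
  have key : ∀ w, (z.2 w : ℝ) - kineticEnergy μ₁ μ₂ z.proj w ≤ kineticEnergy μ₁ μ₂ z.proj v := by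
    intro w
    rw [hv w]
    have e₁ := norm_sub_sq_real (velocity z.proj v).1 (velocity z.proj w).1
    have e₂ := norm_sub_sq_real (velocity z.proj v).2 (velocity z.proj w).2
    have p₁ := mul_nonneg h₁.le (sq_nonneg ‖(velocity z.proj v).1 - (velocity z.proj w).1‖)
    have p₂ := mul_nonneg h₂.le (sq_nonneg ‖(velocity z.proj v).2 - (velocity z.proj w).2‖)
    rw [e₁] at p₁
    rw [e₂] at p₂
    unfold kineticEnergy
    nlinarith
  apply le_antisymm
  · exact ciSup_le key
  · refine le_trans (le_of_eq ?_) (le_ciSup ⟨_, Set.forall_mem_range.2 key⟩ v)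
    rw [hv v]
    simp only [kineticEnergy, real_inner_self_eq_norm_sq]
    ring

/-- The Hamiltonian `T + U(q)` on `T*Q`. -/
def hamiltonian (μ₁ μ₂ : ℝ) (U : ℝ → ℝ) (z : TStarQ) : ℝ :=
  cotangentKineticEnergy μ₁ μ₂ z + U (angleQ z.proj)

/-- The moving frame `(e_x, e_y, e_z)` of a configuration: `e_z` points to the first body, and the
second body lies in the half-plane of the combinations `y e_y + z e_z` with `y > 0`. -/
def bodyFrame (x : Q) : Fin 3 → E3 :=
  let ex := ‖cross (R₂ x) (R₁ x)‖⁻¹ • cross (R₂ x) (R₁ x)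
  ![ex, cross (R₁ x) ex, R₁ x]

/-! ### The reduced phase space `ℝ³ × (0, π) × ℝ` -/

/-- The vector space `ℝ³ × ℝ × ℝ` of triples `(m, q, p)`. -/
abbrev V : Type := E3 × ℝ × ℝ

/-- `ℝ³ × (0, π) × ℝ` as an open submanifold of `ℝ³ × ℝ × ℝ`. -/
def reducedOpens : TopologicalSpace.Opens V where
  carrier := {y | y.2.1 ∈ Set.Ioo 0 Real.pi}
  is_open' := isOpen_Ioo.preimage (by fun_prop)

/-- The reduced phase space. -/
abbrev ReducedSpace : Type := reducedOpens

/-- The coordinate functions `m_x, m_y, m_z` for `i = 0, 1, 2`. -/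
def mCoord (i : Fin 3) (y : ReducedSpace) : ℝ := y.1.1 i

/-- The coordinate function `q`. -/
def qCoord (y : ReducedSpace) : ℝ := y.1.2.1

/-- The coordinate function `p`. -/
def pCoord (y : ReducedSpace) : ℝ := y.1.2.2

/-- The derivative of `f` at `y` in the direction `v ∈ ℝ³ × ℝ × ℝ`. -/
def dirDeriv (f : ReducedSpace → ℝ) (y : ReducedSpace) (v : V) : ℝ :=
  mfderiv 𝓘(ℝ, V) 𝓘(ℝ, ℝ) f y v

/-- The gradient of `f` with respect to `m`. -/
def gradM (f : ReducedSpace → ℝ) (y : ReducedSpace) : E3 :=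
  WithLp.toLp 2 fun i => dirDeriv f y (EuclideanSpace.single i 1, 0, 0)

/-- The product of the Lie-Poisson bracket `-(m, ∂f/∂m × ∂h/∂m)` of `so(3)*` with the canonical
bracket in `(q, p)`. -/
def reducedBracket (f h : ReducedSpace → ℝ) (y : ReducedSpace) : ℝ :=
  -⟪y.1.1, cross (gradM f y) (gradM h y)⟫_ℝ
    + (dirDeriv f y (0, 1, 0) * dirDeriv h y (0, 0, 1)
      - dirDeriv h y (0, 1, 0) * dirDeriv f y (0, 0, 1))

/-- The matrix `A(q)`, for the mass ratio `μ = μ₁ / μ₂`. -/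
def matA (μ q : ℝ) : Matrix (Fin 3) (Fin 3) ℝ :=
  !![1, 0, 0;
     0, 1, Real.cos q / Real.sin q;
     0, Real.cos q / Real.sin q, (μ + Real.cos q ^ 2) / Real.sin q ^ 2]

/-- The reduced Hamiltonian
`(1 / 2μ₁) ((m, A(q) m) + 2 m_x p + (1 + μ) p²) + U(q)` with `μ = μ₁ / μ₂`. -/
def reducedHamiltonian (μ₁ μ₂ : ℝ) (U : ℝ → ℝ) (y : ReducedSpace) : ℝ :=
  let m := y.1.1
  let q := y.1.2.1
  let p := y.1.2.2
  let μ := μ₁ / μ₂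
  1 / (2 * μ₁) * (m.ofLp ⬝ᵥ (matA μ q *ᵥ m.ofLp) + 2 * m 0 * p + (1 + μ) * p ^ 2) + U q

end TwoBody

end

open TwoBody

/-!
The frame `(e_x, e_y, e_z)` trivializes `TQ`: a velocity is a pair `(a, s)`, the angular velocity in
body components together with the rate at which the angle opens. The corresponding components
`(m, p)` of a momentum, together with `q`, are `SO(3)`-invariant and, since `SO(3)` acts simply
transitively on oriented orthonormal frames, separate the orbits. They form a surjective submersion
onto `ℝ³ × (0, π) × ℝ`, which is therefore a model of the orbit space. The canonical bracket of two
momentum components is minus the momentum along the commutator of the body fields; as these fields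
generate rotations about axes fixed in the body, this produces the Lie–Poisson bracket with the
minus sign. In body components the kinetic energy is a quadratic form in `(a, s)`, and inverting its
Legendre transformation explicitly yields the matrix `A(q)`.
-/

noncomputable section

namespace TwoBody

section Cotangent

open VectorField

variable {E : Type*} [NormedAddCommGroup E] [NormedSpace ℝ E]
  {H : Type*} [TopologicalSpace H] {I : ModelWithCorners ℝ E H}
  {M : Type*} [TopologicalSpace M] [ChartedSpace H M]

variable (I) in
/-- The expression of the vector field `X` in the preferred chart at `x₀`. -/
def chartField (X : Π x : M, TangentSpace I x) (x₀ : M) : E → E :=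
  mpullbackWithin 𝓘(ℝ, E) I (extChartAt I x₀).symm X (range I)

/-- The momentum of the vector field `X`: the function on `T*M` that pairs covectors with `X`. -/
def momentumFun (X : Π x : M, TangentSpace I x) (z : CotangentBundle I M) : ℝ :=
  z.2 (X z.proj)

/-- The covector `(b, η) ↦ l b + η v` of `E × E*`, which is the shape of the differentials of
functions on `T*M` in canonical coordinates. -/
def phaseCovector (l : E →L[ℝ] ℝ) (v : E) : E × (E →L[ℝ] ℝ) →L[ℝ] ℝ :=
  l.coprod (ContinuousLinearMap.apply ℝ ℝ v)

theorem phaseCovector_apply (l : E →L[ℝ] ℝ) (v b : E) (η : E →L[ℝ] ℝ) :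
    phaseCovector l v (b, η) = l b + η v := by
  simp [phaseCovector]

theorem phaseCovector_zero : phaseCovector (0 : E →L[ℝ] ℝ) 0 = 0 :=
  ContinuousLinearMap.ext fun v => by rw [phaseCovector_apply, map_zero]; simp

theorem phaseCovector_add (l l' : E →L[ℝ] ℝ) (v v' : E) :
    phaseCovector l v + phaseCovector l' v' = phaseCovector (l + l') (v + v') := by
  refine ContinuousLinearMap.ext fun y => ?_
  obtain ⟨b, η⟩ := y
  simp only [add_apply, phaseCovector_apply, map_add]
  ring

theorem hasFDerivAt_comp_extChartAt_symm {F : Type*} [NormedAddCommGroup F] [NormedSpace ℝ F]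
    [I.Boundaryless] {f : M → F} {x : M} {L : E →L[ℝ] F}
    (hf : HasMFDerivAt I 𝓘(ℝ, F) f x L) :
    HasFDerivAt (f ∘ (extChartAt I x).symm) L (extChartAt I x x) := by
  have h := hf.2
  rw [I.range_eq_univ] at h
  exact hasFDerivWithinAt_univ.1 h

variable [IsManifold I ∞ M]

theorem mfderivWithin_symm_chartField (X : Π x : M, TangentSpace I x) (x₀ : M) {u : E}
    (hu : u ∈ (extChartAt I x₀).target) :
    mfderivWithin 𝓘(ℝ, E) I (extChartAt I x₀).symm (range I) u (chartField I X x₀ u : E) =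
      X ((extChartAt I x₀).symm u) := by
  have h : (mfderivWithin 𝓘(ℝ, E) I (extChartAt I x₀).symm (range I) u).IsInvertible :=
    isInvertible_mfderivWithin_extChartAt_symm hu
  exact (h.inverse_apply_eq.1 rfl).symm

theorem chartField_self (X : Π x : M, TangentSpace I x) (x₀ : M) :
    chartField I X x₀ (extChartAt I x₀ x₀) = X x₀ := by
  have h := mfderivWithin_extChartAt_symm_inverse_apply (I := I) (x := x₀)
    (X ((extChartAt I x₀).symm (extChartAt I x₀ x₀)))
  refine Eq.trans h ?_
  rw [extChartAt_to_inv]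

theorem differentiableAt_chartField [CompleteSpace E] [I.Boundaryless]
    {X : Π x : M, TangentSpace I x} {x₀ : M} (hX : MDiffAt (T% X) x₀) :
    DifferentiableAt ℝ (chartField I X x₀) (extChartAt I x₀ x₀) := by
  have h := hX.mdifferentiableWithinAt (s := univ)
    |>.differentiableWithinAt_mpullbackWithin_vectorField
  refine DifferentiableWithinAt.differentiableAt h ?_
  simp only [preimage_univ, univ_inter, I.range_eq_univ, Filter.univ_mem]

theorem mlieBracket_eq_lieBracket_chartField [I.Boundaryless] (X Y : Π x : M, TangentSpace I x)
    (x : M) : mlieBracket I X Y x =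
      lieBracket ℝ (chartField I X x) (chartField I Y x) (extChartAt I x x) := by
  have h : (mfderiv I 𝓘(ℝ, E) (extChartAt I x) x : E →L[ℝ] E) = ContinuousLinearMap.id ℝ E :=
    mfderiv_extChartAt_self
  have hs : (extChartAt I x).symm ⁻¹' univ ∩ range I = univ := by
    rw [preimage_univ, univ_inter, I.range_eq_univ]
  rw [← lieBracketWithin_univ, ← mlieBracketWithin_univ, mlieBracketWithin_apply, hs]
  refine (congrArg (fun l : E →L[ℝ] E => l.inverse (lieBracketWithin ℝ (chartField I X x)
    (chartField I Y x) univ (extChartAt I x x))) h).trans ?_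
  rw [ContinuousLinearMap.inverse_id, ContinuousLinearMap.id_apply]

theorem extChartAt_cotangent_fst (z z' : CotangentBundle I M) :
    (extChartAt (cotangentModel I) z z').1 = extChartAt I z.proj z'.proj := by
  rw [FiberBundle.extChartAt]; rfl

theorem extChartAt_cotangent_snd (z z' : CotangentBundle I M) :
    (extChartAt (cotangentModel I) z z').2 =
      (z'.2 : E →L[ℝ] ℝ).comp ((trivializationAt E (TangentSpace I) z.proj).symmL ℝ z'.proj) := by
  rw [FiberBundle.extChartAt]
  refine ContinuousLinearMap.ext fun v => ?_
  exact congrArg (fun l : ℝ →L[ℝ] ℝ => l ((z'.2 : E →L[ℝ] ℝ)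
    ((trivializationAt E (TangentSpace I) z.proj).symmL ℝ z'.proj v)))
    (Trivial.continuousLinearMapAt_trivialization ℝ M ℝ z'.proj)

theorem extChartAt_cotangent_self_snd (z : CotangentBundle I M) :
    (extChartAt (cotangentModel I) z z).2 = z.2 := by
  rw [extChartAt_cotangent_snd,
    TangentBundle.symmL_trivializationAt (mem_chart_source _ _)]
  exact congrArg (fun l : E →L[ℝ] E => (z.2 : E →L[ℝ] ℝ).comp l) mfderivWithin_range_extChartAt_symm

theorem momentumFun_eq (X : Π x : M, TangentSpace I x) (z z' : CotangentBundle I M)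
    (h : z'.proj ∈ (chartAt H z.proj).source) :
    momentumFun X z' = (extChartAt (cotangentModel I) z z').2
      (chartField I X z.proj (extChartAt (cotangentModel I) z z').1) := by
  have hs : z'.proj ∈ (extChartAt I z.proj).source := by rwa [extChartAt_source]
  have e := mfderivWithin_symm_chartField X z.proj ((extChartAt I z.proj).map_source hs)
  rw [(extChartAt I z.proj).left_inv hs] at e
  rw [extChartAt_cotangent_snd, extChartAt_cotangent_fst,
    TangentBundle.symmL_trivializationAt h]
  exact (congrArg (z'.2 : E →L[ℝ] ℝ) e).symm

theorem preimage_proj_chartAt_source_mem_nhds (z : CotangentBundle I M) :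
    {z' : CotangentBundle I M | z'.proj ∈ (chartAt H z.proj).source} ∈ nhds z :=
  (FiberBundle.continuous_proj (E →L[ℝ] ℝ) (CotangentSpace I M)).continuousAt.preimage_mem_nhds
    ((chartAt H z.proj).open_source.mem_nhds (mem_chart_source _ _))

theorem momentumFun_eventuallyEq (X : Π x : M, TangentSpace I x) (z : CotangentBundle I M) :
    momentumFun X =ᶠ[nhds z] (fun y : E × (E →L[ℝ] ℝ) => y.2 (chartField I X z.proj y.1)) ∘
      extChartAt (cotangentModel I) z := by
  filter_upwards [preimage_proj_chartAt_source_mem_nhds z] with z' hz'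
  exact momentumFun_eq X z z' hz'

theorem contMDiff_momentumFun {X : Π x : M, TangentSpace I x}
    (hX : ContMDiff I I.tangent ∞ (T% X)) :
    ContMDiff (cotangentModel I) 𝓘(ℝ, ℝ) ∞ (momentumFun X) := by
  intro z
  have h := ContMDiffAt.clm_bundle_apply (x := z) (b := fun z : CotangentBundle I M => z.proj)
    (E₂ := Bundle.Trivial M ℝ)
    (ϕ := fun z => z.2) (v := fun z => X z.proj) contMDiffAt_id
    (hX.contMDiffAt.comp z (contMDiff_proj (CotangentSpace I M)).contMDiffAt)
  exact (Bundle.contMDiffAt_totalSpace.1 h).2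

theorem hasMFDerivAt_extChartAt_self (z : CotangentBundle I M) :
    HasMFDerivAt (cotangentModel I) 𝓘(ℝ, E × (E →L[ℝ] ℝ))
      (extChartAt (cotangentModel I) z) z (ContinuousLinearMap.id ℝ (E × (E →L[ℝ] ℝ))) := by
  have h := ((contMDiffAt_extChartAt (I := cotangentModel I) (n := 1)
    (x := z)).mdifferentiableAt one_ne_zero).hasMFDerivAt
  rwa [mfderiv_extChartAt_self] at h

theorem hasMFDerivAt_momentumFun {X : Π x : M, TangentSpace I x} {x : M} (α : E →L[ℝ] ℝ)
    {A : E →L[ℝ] E} (hX : HasFDerivAt (chartField I X x) A (extChartAt I x x)) :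
    HasMFDerivAt (cotangentModel I) 𝓘(ℝ, ℝ) (momentumFun X) (⟨x, α⟩ : CotangentBundle I M)
      (phaseCovector (α.comp A) (chartField I X x (extChartAt I x x))) := by
  set z : CotangentBundle I M := ⟨x, α⟩
  have hfst : HasFDerivAt (fun y : E × (E →L[ℝ] ℝ) => chartField I X x y.1)
      (A.comp (ContinuousLinearMap.fst ℝ E (E →L[ℝ] ℝ))) (extChartAt (cotangentModel I) z z) := by
    refine HasFDerivAt.comp (g := chartField I X x) _ ?_ hasFDerivAt_fst
    rwa [extChartAt_cotangent_fst]
  have hpair := (hasFDerivAt_snd (𝕜 := ℝ) (p := extChartAt (cotangentModel I) z z)).clm_apply hfst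
  have hz := (hpair.hasMFDerivAt.comp z (hasMFDerivAt_extChartAt_self z)).congr_of_eventuallyEq
    (momentumFun_eventuallyEq X z)
  have e : (extChartAt (cotangentModel I) z z).2.comp
      (A.comp (ContinuousLinearMap.fst ℝ E (E →L[ℝ] ℝ))) +
        (ContinuousLinearMap.snd ℝ E (E →L[ℝ] ℝ)).flip
          (chartField I X x (extChartAt (cotangentModel I) z z).1) =
      phaseCovector (α.comp A) (chartField I X x (extChartAt I x x)) := by
    refine ContinuousLinearMap.ext fun y => ?_
    obtain ⟨b, η⟩ := y
    rw [phaseCovector_apply, extChartAt_cotangent_fst, extChartAt_cotangent_self_snd]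
    rfl
  rw [← e]
  exact hz

theorem hasMFDerivAt_comp_proj [I.Boundaryless] {f : M → ℝ} {z : CotangentBundle I M}
    {l : E →L[ℝ] ℝ} (hf : HasMFDerivAt I 𝓘(ℝ, ℝ) f z.proj l) :
    HasMFDerivAt (cotangentModel I) 𝓘(ℝ, ℝ) (fun z' : CotangentBundle I M => f z'.proj) z
      (phaseCovector l 0) := by
  have hfst : HasFDerivAt (fun y : E × (E →L[ℝ] ℝ) => (f ∘ (extChartAt I z.proj).symm) y.1)
      (l.comp (ContinuousLinearMap.fst ℝ E (E →L[ℝ] ℝ))) (extChartAt (cotangentModel I) z z) := by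
    refine HasFDerivAt.comp (g := f ∘ (extChartAt I z.proj).symm) _ ?_ hasFDerivAt_fst
    rw [extChartAt_cotangent_fst]
    exact hasFDerivAt_comp_extChartAt_symm hf
  have e : l.comp (ContinuousLinearMap.fst ℝ E (E →L[ℝ] ℝ)) = phaseCovector l 0 := by
    refine ContinuousLinearMap.ext fun y => ?_
    obtain ⟨b, η⟩ := y
    rw [phaseCovector_apply, map_zero, add_zero]
    rfl
  rw [← e]
  refine (hfst.hasMFDerivAt.comp z (hasMFDerivAt_extChartAt_self z)).congr_of_eventuallyEq ?_
  filter_upwards [preimage_proj_chartAt_source_mem_nhds z] with z' hz'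
  rw [Function.comp_apply, Function.comp_apply, extChartAt_cotangent_fst,
    (extChartAt I z.proj).left_inv (by rwa [extChartAt_source])]

theorem canonicalBracket_eq [FiniteDimensional ℝ E] {f h : CotangentBundle I M → ℝ}
    {z : CotangentBundle I M} {l l' : E →L[ℝ] ℝ} {v v' : E}
    (hf : HasMFDerivAt (cotangentModel I) 𝓘(ℝ, ℝ) f z (phaseCovector l v))
    (hh : HasMFDerivAt (cotangentModel I) 𝓘(ℝ, ℝ) h z (phaseCovector l' v')) :
    canonicalBracket I f h z = l v' - l' v := by
  have contraction (k : E →L[ℝ] ℝ) (w : E) : ∑ i, k (Module.finBasis ℝ E i) *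
      LinearMap.toContinuousLinearMap ((Module.finBasis ℝ E).coord i) w = k w := by
    conv_rhs => rw [← (Module.finBasis ℝ E).sum_repr w]
    simp only [map_sum, map_smul, smul_eq_mul]
    exact Finset.sum_congr rfl fun i _ => mul_comm _ _
  rw [canonicalBracket, hf.mfderiv, hh.mfderiv, ← contraction l v', ← contraction l' v,
    ← Finset.sum_sub_distrib]
  refine Finset.sum_congr rfl fun i _ => ?_
  change phaseCovector l v (_, _) * phaseCovector l' v' (_, _) -
    phaseCovector l' v' (_, _) * phaseCovector l v (_, _) = _
  simp only [phaseCovector_apply, map_zero, zero_apply, add_zero, zero_add]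

theorem canonicalBracket_congr [FiniteDimensional ℝ E] {f f' h h' : CotangentBundle I M → ℝ}
    {z : CotangentBundle I M}
    (hf : mfderiv (cotangentModel I) 𝓘(ℝ, ℝ) f z = mfderiv (cotangentModel I) 𝓘(ℝ, ℝ) f' z)
    (hh : mfderiv (cotangentModel I) 𝓘(ℝ, ℝ) h z = mfderiv (cotangentModel I) 𝓘(ℝ, ℝ) h' z) :
    canonicalBracket I f h z = canonicalBracket I f' h' z := by
  simp only [canonicalBracket, hf, hh]

theorem canonicalBracket_momentumFun_add_comp_proj [FiniteDimensional ℝ E] [I.Boundaryless]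
    {X Y : Π x : M, TangentSpace I x} {f h : M → ℝ} {z : CotangentBundle I M} {l l' : E →L[ℝ] ℝ}
    (hX : MDiffAt (T% X) z.proj) (hY : MDiffAt (T% Y) z.proj)
    (hf : HasMFDerivAt I 𝓘(ℝ, ℝ) f z.proj l) (hh : HasMFDerivAt I 𝓘(ℝ, ℝ) h z.proj l') :
    canonicalBracket I (fun z => momentumFun X z + f z.proj)
      (fun z => momentumFun Y z + h z.proj) z =
      -momentumFun (mlieBracket I X Y) z + (l (Y z.proj) - l' (X z.proj)) := by
  obtain ⟨x, α : E →L[ℝ] ℝ⟩ := z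
  have hX' := (hasMFDerivAt_momentumFun α (differentiableAt_chartField hX).hasFDerivAt).add
    (hasMFDerivAt_comp_proj hf)
  have hY' := (hasMFDerivAt_momentumFun α (differentiableAt_chartField hY).hasFDerivAt).add
    (hasMFDerivAt_comp_proj hh)
  have hbracket : momentumFun (mlieBracket I X Y) (⟨x, α⟩ : CotangentBundle I M) =
      α (lieBracket ℝ (chartField I X x) (chartField I Y x) (extChartAt I x x)) :=
    congrArg α (mlieBracket_eq_lieBracket_chartField X Y x)
  refine (canonicalBracket_eq (hX'.congr_mfderiv (phaseCovector_add ..))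
    (hY'.congr_mfderiv (phaseCovector_add ..))).trans ?_
  have hYx : l (Y x) = l (chartField I Y x (extChartAt I x x)) :=
    congrArg l (chartField_self Y x).symm
  have hXx : l' (X x) = l' (chartField I X x (extChartAt I x x)) :=
    congrArg l' (chartField_self X x).symm
  rw [hbracket, hYx, hXx, lieBracket, map_sub, add_zero, add_zero]
  simp only [add_apply, ContinuousLinearMap.comp_apply]
  ring

end Cotangent

section VectorFields

open VectorField

variable {E : Type*} [NormedAddCommGroup E] [NormedSpace ℝ E]
  {H : Type*} [TopologicalSpace H] {I : ModelWithCorners ℝ E H}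
  {M : Type*} [TopologicalSpace M] [ChartedSpace H M]
  {F : Type*} [NormedAddCommGroup F] [NormedSpace ℝ F]

theorem contMDiffAt_of_clm_apply [FiniteDimensional ℝ E] [FiniteDimensional ℝ F]
    {E' : Type*} [NormedAddCommGroup E'] [NormedSpace ℝ E'] {n : ℕ∞ω}
    {H' : Type*} [TopologicalSpace H'] {J : ModelWithCorners ℝ E' H'}
    {N : Type*} [TopologicalSpace N] [ChartedSpace H' N] {L : N → E →L[ℝ] F} {v : N → E} {x : N}
    (hL : ContMDiffAt J 𝓘(ℝ, E →L[ℝ] F) n L x) (hinj : Function.Injective (L x))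
    (hv : ContMDiffAt J 𝓘(ℝ, F) n (fun y => L y (v y)) x) : ContMDiffAt J 𝓘(ℝ, E) n v x := by
  obtain ⟨P, hP⟩ := ContinuousLinearMap.HasLeftInverse.of_injective_of_finiteDimensional hinj
  have hPL : ContMDiffAt J 𝓘(ℝ, E →L[ℝ] E) n (fun y => P.comp (L y)) x :=
    contMDiffAt_const.clm_comp hL
  have hx : P.comp (L x) = (ContinuousLinearEquiv.refl ℝ E : E →L[ℝ] E) :=
    ContinuousLinearMap.ext hP
  have hinv : ContMDiffAt J 𝓘(ℝ, E →L[ℝ] E) n (fun y => (P.comp (L y)).inverse) x := by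
    refine ContMDiffAt.comp (g := ContinuousLinearMap.inverse) x ?_ hPL
    rw [hx]
    exact (contDiffAt_map_inverse _).contMDiffAt
  have hunit : ∀ᶠ y in nhds x, (P.comp (L y)).IsInvertible := by
    have h := ContinuousLinearEquiv.nhds (ContinuousLinearEquiv.refl ℝ E)
    rw [← hx] at h
    exact hPL.continuousAt.eventually h
  refine (hinv.clm_apply (contMDiffAt_const (c := P) |>.clm_apply hv)).congr_of_eventuallyEq ?_
  filter_upwards [hunit] with y hy
  exact (hy.inverse_apply_eq.2 rfl).symm

variable [IsManifold I ∞ M]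

theorem contMDiff_of_mfderiv_apply [FiniteDimensional ℝ E] [FiniteDimensional ℝ F]
    {f : M → F} (hf : ContMDiff I 𝓘(ℝ, F) ∞ f)
    (hinj : ∀ x, Function.Injective (mfderiv I 𝓘(ℝ, F) f x)) {X : Π x : M, TangentSpace I x}
    {X' : M → F} (hX : ∀ x, mfderiv I 𝓘(ℝ, F) f x (X x) = X' x)
    (hX' : ContMDiff I 𝓘(ℝ, F) ∞ X') : ContMDiff I I.tangent ∞ (T% X) := by
  intro x
  refine (contMDiffAt_section x).2 ?_
  have hdf := (hf x).mfderiv_const (m := ∞) (by simp)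
  have hcoord : ∀ y ∈ (chartAt H x).source, ∀ w : TangentSpace I y,
      inTangentCoordinates I 𝓘(ℝ, F) id f (mfderiv I 𝓘(ℝ, F) f) x y
        (trivializationAt E (TangentSpace I) x ⟨y, w⟩).2 = mfderiv I 𝓘(ℝ, F) f y w := by
    intro y hy w
    have hw : (trivializationAt E (TangentSpace I) x).symmL ℝ y
        (trivializationAt E (TangentSpace I) x ⟨y, w⟩).2 = w := by
      rw [← Trivialization.continuousLinearMapAt_apply_of_mem ℝ _ hy,
        Trivialization.symmL_continuousLinearMapAt _ hy]
    have hF := TangentBundle.continuousLinearMapAt_model_space (𝕜 := ℝ) (f x) (f y)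
    refine (congrArg (fun l : F →L[ℝ] F => l (mfderiv I 𝓘(ℝ, F) f y ((trivializationAt E
      (TangentSpace I) x).symmL ℝ y (trivializationAt E (TangentSpace I) x ⟨y, w⟩).2))) hF).trans ?_
    exact congrArg (mfderiv I 𝓘(ℝ, F) f y) hw
  refine contMDiffAt_of_clm_apply hdf ?_ ?_
  · have hsurj (v : E) : ∃ w : TangentSpace I x,
        (trivializationAt E (TangentSpace I) x ⟨x, w⟩).2 = v :=
      ⟨(trivializationAt E (TangentSpace I) x).symmL ℝ x v, by
        rw [← Trivialization.continuousLinearMapAt_apply_of_mem ℝ _ (mem_chart_source H x),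
          Trivialization.continuousLinearMapAt_symmL _ (mem_chart_source H x)]⟩
    intro v v' h
    obtain ⟨w, rfl⟩ := hsurj v
    obtain ⟨w', rfl⟩ := hsurj v'
    rw [hcoord x (mem_chart_source H x), hcoord x (mem_chart_source H x)] at h
    rw [hinj x h]
  · refine hX'.contMDiffAt.congr_of_eventuallyEq ?_
    filter_upwards [(chartAt H x).open_source.mem_nhds (mem_chart_source H x)] with y hy
    exact (hcoord y hy (X y)).trans (hX y)

theorem fderiv_comp_extChartAt_symm_chartField [I.Boundaryless] {f : M → F}
    (hf : MDifferentiable I 𝓘(ℝ, F) f) (X : Π x : M, TangentSpace I x) (x₀ : M) {u : E}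
    (hu : u ∈ (extChartAt I x₀).target) :
    fderiv ℝ (f ∘ (extChartAt I x₀).symm) u (chartField I X x₀ u) =
      mfderiv I 𝓘(ℝ, F) f ((extChartAt I x₀).symm u) (X ((extChartAt I x₀).symm u)) := by
  have hs := mdifferentiableWithinAt_extChartAt_symm (I := I) hu
  have hX := mfderivWithin_symm_chartField X x₀ hu
  rw [I.range_eq_univ, mfderivWithin_univ] at hX
  rw [I.range_eq_univ, mdifferentiableWithinAt_univ] at hs
  rw [← mfderiv_eq_fderiv, mfderiv_comp _ (hf _) hs]
  exact congrArg _ hX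

theorem mfderiv_mlieBracket [CompleteSpace E] [I.Boundaryless] {f : M → F}
    (hf : ContMDiff I 𝓘(ℝ, F) ∞ f) {X Y : Π x : M, TangentSpace I x} {x : M}
    (hX : MDiffAt (T% X) x) (hY : MDiffAt (T% Y) x) {X' Y' : M → F} {A B : E →L[ℝ] F}
    (hfX : ∀ y, mfderiv I 𝓘(ℝ, F) f y (X y) = X' y)
    (hfY : ∀ y, mfderiv I 𝓘(ℝ, F) f y (Y y) = Y' y)
    (hA : HasMFDerivAt I 𝓘(ℝ, F) X' x A) (hB : HasMFDerivAt I 𝓘(ℝ, F) Y' x B) :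
    mfderiv I 𝓘(ℝ, F) f x (mlieBracket I X Y x) = B (X x) - A (Y x) := by
  have hfx := (hf.mdifferentiable (by simp) x).hasMFDerivAt
  have hG : ContDiffAt ℝ ∞ (f ∘ (extChartAt I x).symm) (extChartAt I x x) := by
    have h := (contMDiffAt_iff.1 (hf x)).2
    rwa [I.range_eq_univ, contDiffWithinAt_univ] at h
  have hchart {Z : Π x : M, TangentSpace I x} {Z' : M → F}
      (hZ : ∀ y, mfderiv I 𝓘(ℝ, F) f y (Z y) = Z' y) :
      (fun u => fderiv ℝ (f ∘ (extChartAt I x).symm) u (chartField I Z x u)) =ᶠ[nhds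
        (extChartAt I x x)] Z' ∘ (extChartAt I x).symm := by
    filter_upwards [(isOpen_extChartAt_target x).mem_nhds (mem_extChartAt_target x)] with u hu
    exact (fderiv_comp_extChartAt_symm_chartField (hf.mdifferentiable (by simp)) Z x hu).trans
      (hZ _)
  have h := fderiv_apply_lieBracket hG
    (by simpa using WithTop.coe_le_coe.2 (le_top : (2 : ℕ∞) ≤ ⊤)) (differentiableAt_chartField hY)
    (differentiableAt_chartField hX)
  rw [(hchart hfX).fderiv_eq, (hchart hfY).fderiv_eq,
    (hasFDerivAt_comp_extChartAt_symm hA).fderiv, (hasFDerivAt_comp_extChartAt_symm hB).fderiv,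
    (hasFDerivAt_comp_extChartAt_symm hfx).fderiv, ← mlieBracket_eq_lieBracket_chartField,
    chartField_self, chartField_self] at h
  exact h

end VectorFields

section PoissonMaps

variable {E : Type*} [NormedAddCommGroup E] [NormedSpace ℝ E]
  {H : Type*} [TopologicalSpace H] {I : ModelWithCorners ℝ E H}
  {M : Type*} [TopologicalSpace M] [ChartedSpace H M]
  {E' : Type*} [NormedAddCommGroup E'] [NormedSpace ℝ E']
  {H' : Type*} [TopologicalSpace H'] {I' : ModelWithCorners ℝ E' H'}
  {M' : Type*} [TopologicalSpace M'] [ChartedSpace H' M']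
  {E'' : Type*} [NormedAddCommGroup E''] [NormedSpace ℝ E'']
  {H'' : Type*} [TopologicalSpace H''] {I'' : ModelWithCorners ℝ E'' H''}
  {M'' : Type*} [TopologicalSpace M''] [ChartedSpace H'' M'']
  {br : (M → ℝ) → (M → ℝ) → M → ℝ} {br' : (M' → ℝ) → (M' → ℝ) → M' → ℝ}

/-- The bracket on `M` that corresponds to the bracket `br'` on `M'` under the diffeomorphism
`φ`. -/
def pullbackBracket (φ : Diffeomorph I I' M M' ∞) (br' : (M' → ℝ) → (M' → ℝ) → M' → ℝ)
    (f h : M → ℝ) : M → ℝ :=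
  br' (f ∘ φ.symm) (h ∘ φ.symm) ∘ φ

theorem pullbackBracket_comp (φ : Diffeomorph I I' M M' ∞) (f h : M' → ℝ) :
    pullbackBracket φ br' (f ∘ φ) (h ∘ φ) = br' f h ∘ φ := by
  have hc (f : M' → ℝ) : (f ∘ φ) ∘ φ.symm = f := funext fun y => congrArg f (φ.apply_symm_apply y)
  rw [pullbackBracket, hc, hc]

theorem IsPoissonBracket.pullback (h : IsPoissonBracket I' br') (φ : Diffeomorph I I' M M' ∞) :
    IsPoissonBracket I (pullbackBracket φ br') := by
  have hs {f : M → ℝ} (hf : SmoothFun I f) : SmoothFun I' (f ∘ φ.symm) :=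
    hf.comp φ.symm.contMDiff
  have hc (f : M' → ℝ) : (f ∘ φ) ∘ φ.symm = f :=
    funext fun y => congrArg f (φ.apply_symm_apply y)
  refine ⟨fun f k hf hk => (h.smooth _ _ (hs hf) (hs hk)).comp φ.contMDiff,
    fun f k hf hk => ?_, fun f₁ f₂ k hf₁ hf₂ hk => ?_, fun c f k hf hk => ?_,
    fun f₁ f₂ k hf₁ hf₂ hk => ?_, fun f₁ f₂ f₃ hf₁ hf₂ hf₃ => ?_⟩
  · exact congrArg (· ∘ φ) (h.skew _ _ (hs hf) (hs hk))
  · exact congrArg (· ∘ φ) (h.add_left _ _ _ (hs hf₁) (hs hf₂) (hs hk))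
  · exact congrArg (· ∘ φ) (h.smul_left c _ _ (hs hf) (hs hk))
  · refine (congrArg (· ∘ φ) (h.leibniz _ _ _ (hs hf₁) (hs hf₂) (hs hk))).trans ?_
    ext x
    simp [pullbackBracket]
  · have e := congrArg (· ∘ φ) (h.jacobi _ _ _ (hs hf₁) (hs hf₂) (hs hf₃))
    simp only [pullbackBracket, hc]
    exact e

theorem isPoissonMap_pullbackBracket (φ : Diffeomorph I I' M M' ∞) :
    IsPoissonMap I I' (pullbackBracket φ br') br' φ :=
  ⟨φ.contMDiff, fun f h _ _ z => congrFun (pullbackBracket_comp φ f h) z⟩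

theorem IsPoissonMap.symm_comp {φ : M → M''} {br'' : (M'' → ℝ) → (M'' → ℝ) → M'' → ℝ}
    (hφ : IsPoissonMap I I'' br br'' φ) (ψ : Diffeomorph I' I'' M' M'' ∞) :
    IsPoissonMap I I' br (pullbackBracket ψ br'') (ψ.symm ∘ φ) := by
  refine ⟨ψ.symm.contMDiff.comp hφ.1, fun f h hf hh z => ?_⟩
  refine (hφ.2 _ _ (hf.comp ψ.symm.contMDiff) (hh.comp ψ.symm.contMDiff) z).trans ?_
  simp [pullbackBracket]

theorem IsHamiltonianTrajectory.map {φ : M → M'} (hφ : ContMDiff I I' ∞ φ) {h : M → ℝ}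
    {h' : M' → ℝ} (hbr : ∀ f, SmoothFun I' f → ∀ z, br (f ∘ φ) h z = br' f h' (φ z))
    {J : Set ℝ} {γ : ℝ → M} (hγ : IsHamiltonianTrajectory I br h J γ) :
    IsHamiltonianTrajectory I' br' h' J (φ ∘ γ) := fun t ht f hf => by
  have hd := hγ t ht (f ∘ φ) (hf.comp hφ)
  rwa [hbr f hf] at hd

theorem IsSmoothSubmersion.diffeomorph_comp {φ : M → M'} (hφ : IsSmoothSubmersion I I' φ)
    (ψ : Diffeomorph I' I'' M' M'' ∞) : IsSmoothSubmersion I I'' (ψ ∘ φ) := by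
  refine ⟨ψ.contMDiff.comp hφ.1, fun z => ?_⟩
  rw [mfderiv_comp z (ψ.mdifferentiable (by simp) _) (hφ.1.mdifferentiable (by simp) z)]
  exact (ψ.mfderivToContinuousLinearEquiv (by simp) (φ z)).surjective.comp (hφ.2 z)

end PoissonMaps

section PoissonTensors

variable {E : Type*} [NormedAddCommGroup E] [NormedSpace ℝ E]

theorem hasMFDerivAt_subtype_val {H : Type*} [TopologicalSpace H] {I : ModelWithCorners ℝ E H}
    {M : Type*} [TopologicalSpace M] [ChartedSpace H M] {U : TopologicalSpace.Opens M} (x : U) :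
    HasMFDerivAt I I (Subtype.val : U → M) x (ContinuousLinearMap.id ℝ E) := by
  refine ⟨continuous_subtype_val.continuousAt, ?_⟩
  have hid : writtenInExtChartAt I I x (Subtype.val : U → M)
      =ᶠ[nhdsWithin (extChartAt I x x) (range I)] id := by
    filter_upwards [extChartAt_target_mem_nhdsWithin (I := I) x] with u hu
    have h := (extChartAt I x).right_inv hu
    simpa [writtenInExtChartAt, extChartAt] using! h
  exact (hasFDerivWithinAt_id (𝕜 := ℝ) (extChartAt I x x) (range I)).congr_of_eventuallyEq hid
    (hid.eq_of_nhdsWithin (mem_range_self _))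

variable {U : TopologicalSpace.Opens E}

/-- The extension by zero of a function on an open set. -/
def extendFun (f : U → ℝ) : E → ℝ := Function.extend Subtype.val f 0

omit [NormedSpace ℝ E] in
theorem extendFun_val (f : U → ℝ) (y : U) : extendFun f y.1 = f y :=
  Subtype.val_injective.extend_apply f 0 y

omit [NormedSpace ℝ E] in
theorem extendFun_eventuallyEq {f : U → ℝ} {F : E → ℝ} (h : ∀ y : U, f y = F y.1) (y : U) :
    extendFun f =ᶠ[nhds y.1] F := by
  filter_upwards [U.isOpen.mem_nhds y.2] with y' hy'
  exact (extendFun_val f ⟨y', hy'⟩).trans (h ⟨y', hy'⟩)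

theorem contDiffAt_extendFun {f : U → ℝ} (hf : SmoothFun 𝓘(ℝ, E) f) (y : U) :
    ContDiffAt ℝ ∞ (extendFun f) y.1 := by
  have e : (fun y : U => extendFun f y.1) = f := funext (extendFun_val f)
  rw [← contMDiffAt_iff_contDiffAt, ← contMDiffAt_subtype_iff, e]
  exact hf y

/-- The differential at `y` of a function on an open set of `E`, as a covector of `E`. -/
def differential (f : U → ℝ) (y : U) : E →L[ℝ] ℝ := mfderiv 𝓘(ℝ, E) 𝓘(ℝ, ℝ) f y

theorem hasMFDerivAt_comp_val {F : E → ℝ} {y : U} {l : E →L[ℝ] ℝ} (hF : HasFDerivAt F l y.1) :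
    HasMFDerivAt 𝓘(ℝ, E) 𝓘(ℝ, ℝ) (fun y : U => F y.1) y l :=
  hF.hasMFDerivAt.comp y (hasMFDerivAt_subtype_val (I := 𝓘(ℝ, E)) y)

theorem differential_comp_val {F : E → ℝ} {y : U} {l : E →L[ℝ] ℝ} (hF : HasFDerivAt F l y.1) :
    differential (fun y : U => F y.1) y = l :=
  (hasMFDerivAt_comp_val hF).mfderiv

theorem differential_eq_fderiv_extendFun {f : U → ℝ} (hf : SmoothFun 𝓘(ℝ, E) f) (y : U) :
    differential f y = fderiv ℝ (extendFun f) y.1 := by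
  have h := differential_comp_val
    ((contDiffAt_extendFun hf y).differentiableAt (by simp)).hasFDerivAt
  simpa only [extendFun_val] using h

/-- The bracket `{f, h}(y) = df_y (P_y dh_y)` of functions on the open set `U` that is given by
the contravariant two-tensor `P`. -/
def tensorBracket (P : E → (E →L[ℝ] ℝ) →L[ℝ] E) (f h : U → ℝ) (y : U) : ℝ :=
  differential f y (P y.1 (differential h y))

variable (U) in
/-- `P` is a smooth bivector on the open set `U` whose Schouten bracket with itself vanishes. -/
structure IsPoissonTensor (P : E → (E →L[ℝ] ℝ) →L[ℝ] E) : Prop where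
  contDiffAt : ∀ y ∈ U, ContDiffAt ℝ ∞ P y
  skew : ∀ y ∈ U, ∀ α β : E →L[ℝ] ℝ, α (P y β) = -β (P y α)
  schouten : ∀ y ∈ U, ∀ α β γ : E →L[ℝ] ℝ, α (fderiv ℝ P y (P y β) γ) +
    β (fderiv ℝ P y (P y γ) α) + γ (fderiv ℝ P y (P y α) β) = 0

variable {P : E → (E →L[ℝ] ℝ) →L[ℝ] E}

theorem tensorBracket_eq {f h : U → ℝ} (hf : SmoothFun 𝓘(ℝ, E) f) (hh : SmoothFun 𝓘(ℝ, E) h)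
    (y : U) : tensorBracket P f h y =
      fderiv ℝ (extendFun f) y.1 (P y.1 (fderiv ℝ (extendFun h) y.1)) := by
  rw [tensorBracket, differential_eq_fderiv_extendFun hf, differential_eq_fderiv_extendFun hh]

theorem smoothFun_tensorBracket (hP : ∀ y ∈ U, ContDiffAt ℝ ∞ P y) {f h : U → ℝ}
    (hf : SmoothFun 𝓘(ℝ, E) f) (hh : SmoothFun 𝓘(ℝ, E) h) :
    SmoothFun 𝓘(ℝ, E) (tensorBracket P f h) := by
  have hd {f : U → ℝ} (hf : SmoothFun 𝓘(ℝ, E) f) (y : U) :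
      ContDiffAt ℝ ∞ (fderiv ℝ (extendFun f)) y.1 :=
    (contDiffAt_extendFun hf y).fderiv_right le_rfl
  rw [show tensorBracket P f h = fun y : U => _ from funext (tensorBracket_eq hf hh)]
  intro y
  exact contMDiffAt_subtype_iff.2
    ((hd hf y).clm_apply ((hP y.1 y.2).clm_apply (hd hh y))).contMDiffAt

theorem fderiv_extendFun_tensorBracket_apply (hP : ∀ y ∈ U, ContDiffAt ℝ ∞ P y) {f h : U → ℝ}
    (hf : SmoothFun 𝓘(ℝ, E) f) (hh : SmoothFun 𝓘(ℝ, E) h) (y : U) (v : E) :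
    fderiv ℝ (extendFun (tensorBracket P f h)) y.1 v =
      fderiv ℝ (fderiv ℝ (extendFun f)) y.1 v (P y.1 (fderiv ℝ (extendFun h) y.1)) +
      fderiv ℝ (extendFun f) y.1 (fderiv ℝ P y.1 v (fderiv ℝ (extendFun h) y.1)) +
      fderiv ℝ (extendFun f) y.1 (P y.1 (fderiv ℝ (fderiv ℝ (extendFun h)) y.1 v)) := by
  have hd {f : U → ℝ} (hf : SmoothFun 𝓘(ℝ, E) f) :=
    (((contDiffAt_extendFun hf y).fderiv_right (m := ∞) le_rfl).differentiableAt
      (by simp)).hasFDerivAt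
  have hPy := ((hP y.1 y.2).differentiableAt (by simp)).hasFDerivAt
  rw [(extendFun_eventuallyEq (F := fun y => fderiv ℝ (extendFun f) y
      (P y (fderiv ℝ (extendFun h) y))) (tensorBracket_eq hf hh) y).fderiv_eq,
    ((hd hf).clm_apply (hPy.clm_apply (hd hh))).fderiv]
  simp only [add_apply, ContinuousLinearMap.comp_apply,
    ContinuousLinearMap.flip_apply, map_add]
  ring

theorem IsPoissonTensor.tensorBracket_tensorBracket (hP : IsPoissonTensor U P) {f g h : U → ℝ}
    (hf : SmoothFun 𝓘(ℝ, E) f) (hg : SmoothFun 𝓘(ℝ, E) g) (hh : SmoothFun 𝓘(ℝ, E) h) (y : U) :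
    tensorBracket P f (tensorBracket P g h) y =
      fderiv ℝ (fderiv ℝ (extendFun h)) y.1 (P y.1 (fderiv ℝ (extendFun f) y.1))
        (P y.1 (fderiv ℝ (extendFun g) y.1)) -
      fderiv ℝ (fderiv ℝ (extendFun g)) y.1 (P y.1 (fderiv ℝ (extendFun f) y.1))
        (P y.1 (fderiv ℝ (extendFun h) y.1)) -
      fderiv ℝ (extendFun g) y.1 (fderiv ℝ P y.1 (P y.1 (fderiv ℝ (extendFun f) y.1))
        (fderiv ℝ (extendFun h) y.1)) := by
  rw [tensorBracket_eq hf (smoothFun_tensorBracket hP.contDiffAt hg hh), hP.skew y.1 y.2,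
    fderiv_extendFun_tensorBracket_apply hP.contDiffAt hg hh,
    hP.skew y.1 y.2 (fderiv ℝ (extendFun g) y.1) (fderiv ℝ (fderiv ℝ (extendFun h)) y.1 _)]
  ring

theorem IsPoissonTensor.jacobi (hP : IsPoissonTensor U P) {f₁ f₂ f₃ : U → ℝ}
    (h₁ : SmoothFun 𝓘(ℝ, E) f₁) (h₂ : SmoothFun 𝓘(ℝ, E) f₂) (h₃ : SmoothFun 𝓘(ℝ, E) f₃) :
    tensorBracket P f₁ (tensorBracket P f₂ f₃) + tensorBracket P f₂ (tensorBracket P f₃ f₁) +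
      tensorBracket P f₃ (tensorBracket P f₁ f₂) = 0 := by
  ext y
  have hessian_symm {f : U → ℝ} (hf : SmoothFun 𝓘(ℝ, E) f) (v w : E) :
      fderiv ℝ (fderiv ℝ (extendFun f)) y.1 v w = fderiv ℝ (fderiv ℝ (extendFun f)) y.1 w v :=
    (contDiffAt_extendFun hf y).isSymmSndFDerivAt
      (by simpa using WithTop.coe_le_coe.2 (le_top : (2 : ℕ∞) ≤ ⊤)) v w
  rw [Pi.add_apply, Pi.add_apply, hP.tensorBracket_tensorBracket h₁ h₂ h₃,
    hP.tensorBracket_tensorBracket h₂ h₃ h₁, hP.tensorBracket_tensorBracket h₃ h₁ h₂,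
    Pi.zero_apply]
  linarith [hP.schouten y.1 y.2 (fderiv ℝ (extendFun f₂) y.1) (fderiv ℝ (extendFun f₁) y.1)
      (fderiv ℝ (extendFun f₃) y.1),
    hessian_symm h₁ (P y.1 (fderiv ℝ (extendFun f₂) y.1)) (P y.1 (fderiv ℝ (extendFun f₃) y.1)),
    hessian_symm h₂ (P y.1 (fderiv ℝ (extendFun f₁) y.1)) (P y.1 (fderiv ℝ (extendFun f₃) y.1)),
    hessian_symm h₃ (P y.1 (fderiv ℝ (extendFun f₁) y.1)) (P y.1 (fderiv ℝ (extendFun f₂) y.1))]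

theorem IsPoissonTensor.isPoissonBracket (hP : IsPoissonTensor U P) :
    IsPoissonBracket 𝓘(ℝ, E) (tensorBracket (U := U) P) := by
  have hd {f : U → ℝ} (hf : SmoothFun 𝓘(ℝ, E) f) (y : U) :=
    (hf.mdifferentiable (by simp) y).hasMFDerivAt
  refine ⟨fun f h hf hh => smoothFun_tensorBracket hP.contDiffAt hf hh,
    fun f h _ _ => funext fun y => hP.skew y.1 y.2 _ _,
    fun f₁ f₂ h h₁ h₂ _ => funext fun y => ?_, fun c f h hf _ => funext fun y => ?_,
    fun f₁ f₂ h h₁ h₂ _ => funext fun y => ?_, fun f₁ f₂ f₃ => hP.jacobi⟩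
  · rw [tensorBracket, differential, ((hd h₁ y).add (hd h₂ y)).mfderiv]
    rfl
  · rw [tensorBracket, differential, ((hd hf y).const_smul c).mfderiv]
    rfl
  · rw [tensorBracket, differential, ((hd h₁ y).mul (hd h₂ y)).mfderiv]
    rfl

set_option synthInstance.maxHeartbeats 40000 in
-- The norm of the nested operator space `(E →L[ℝ] ℝ) →L[ℝ] E` is found just beyond the default.
theorem IsPoissonTensor.of_affine {L : E →L[ℝ] (E →L[ℝ] ℝ) →L[ℝ] E} {C : (E →L[ℝ] ℝ) →L[ℝ] E}
    (hskew : ∀ y ∈ U, ∀ α β : E →L[ℝ] ℝ, α (L y β + C β) = -β (L y α + C α))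
    (hschouten : ∀ y ∈ U, ∀ α β γ : E →L[ℝ] ℝ, α (L (L y β + C β) γ) +
      β (L (L y γ + C γ) α) + γ (L (L y α + C α) β) = 0) :
    IsPoissonTensor U fun y => L y + C where
  contDiffAt _ _ := by fun_prop
  skew := hskew
  schouten y hy α β γ := by
    have hd : HasFDerivAt (fun y => L y + C) L y :=
      (ContinuousLinearMap.hasFDerivAt (𝕜 := ℝ) L).add_const C
    rw [hd.fderiv]
    exact hschouten y hy α β γ

end PoissonTensors

section CrossProduct

theorem cross_add_left (a b c : E3) : cross (a + b) c = cross a c + cross b c := by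
  simp [cross]

theorem cross_add_right (a b c : E3) : cross a (b + c) = cross a b + cross a c := by
  simp [cross]

theorem cross_smul_left (r : ℝ) (a b : E3) : cross (r • a) b = r • cross a b := by
  simp [cross]

theorem cross_smul_right (r : ℝ) (a b : E3) : cross a (r • b) = r • cross a b := by
  simp [cross]

/-- The vector product as a continuous bilinear map, which supplies its derivatives. -/
def crossL : E3 →L[ℝ] E3 →L[ℝ] E3 :=
  (LinearMap.mk₂ ℝ cross cross_add_left cross_smul_left cross_add_right
    cross_smul_right).toContinuousBilinearMap

theorem cross_anticomm (a b : E3) : cross a b = -cross b a := by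
  simp only [cross, ← WithLp.toLp_neg]
  rw [_root_.cross_anticomm]

theorem cross_zero_right (a : E3) : cross a 0 = 0 := by
  simp [cross]

theorem cross_cross (a b c : E3) :
    cross (cross a b) c = cross a (cross b c) - cross b (cross a c) := by
  simp only [cross, ← WithLp.toLp_sub]
  rw [_root_.cross_cross]

theorem inner_eq_sum (a b : E3) : ⟪a, b⟫_ℝ = a 0 * b 0 + a 1 * b 1 + a 2 * b 2 := by
  simp [PiLp.inner_apply, Fin.sum_univ_three, mul_comm]

theorem cross_apply_zero (a b : E3) : cross a b 0 = a 1 * b 2 - a 2 * b 1 := by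
  simp [cross, cross_apply]

theorem cross_apply_one (a b : E3) : cross a b 1 = a 2 * b 0 - a 0 * b 2 := by
  simp [cross, cross_apply]

theorem cross_apply_two (a b : E3) : cross a b 2 = a 0 * b 1 - a 1 * b 0 := by
  simp [cross, cross_apply]

theorem inner_cross_self_left (a b : E3) : ⟪a, cross a b⟫_ℝ = 0 := by
  simp only [inner_eq_sum, cross_apply_zero, cross_apply_one, cross_apply_two]; ring

theorem inner_cross_perm (a b c : E3) : ⟪a, cross b c⟫_ℝ = ⟪b, cross c a⟫_ℝ := by
  simp only [inner_eq_sum, cross_apply_zero, cross_apply_one, cross_apply_two]; ring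

theorem cross_cross_right (a b c : E3) :
    cross a (cross b c) = ⟪a, c⟫_ℝ • b - ⟪a, b⟫_ℝ • c := by
  ext i
  fin_cases i <;> simp [inner_eq_sum, cross_apply_zero, cross_apply_one, cross_apply_two] <;> ring

theorem inner_cross_cross (a b c d : E3) :
    ⟪cross a b, cross c d⟫_ℝ = ⟪a, c⟫_ℝ * ⟪b, d⟫_ℝ - ⟪a, d⟫_ℝ * ⟪b, c⟫_ℝ := by
  simp only [inner_eq_sum, cross_apply_zero, cross_apply_one, cross_apply_two]; ring

theorem norm_cross_sq (a b : E3) : ‖cross a b‖ ^ 2 = ‖a‖ ^ 2 * ‖b‖ ^ 2 - ⟪a, b⟫_ℝ ^ 2 := by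
  rw [← real_inner_self_eq_norm_sq, inner_cross_cross, real_inner_self_eq_norm_sq,
    real_inner_self_eq_norm_sq, real_inner_comm a b]
  ring

theorem hasDerivAt_cross {f g : ℝ → E3} {f' g' : E3} {t : ℝ} (hf : HasDerivAt f f' t)
    (hg : HasDerivAt g g' t) :
    HasDerivAt (fun s => cross (f s) (g s)) (cross f' (g t) + cross (f t) g') t := by
  have h := crossL.hasDerivAt_of_bilinear (fun _ => hf) (fun _ => hg)
  rw [add_comm]
  exact h

end CrossProduct

section Normalization

variable {F : Type*} [NormedAddCommGroup F] [InnerProductSpace ℝ F]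

theorem hasDerivAt_normalize {n : ℝ → F} {v : F} {c t : ℝ} (hn : HasDerivAt n (v + c • n t) t)
    (h0 : n t ≠ 0) (hv : ⟪n t, v⟫_ℝ = 0) :
    HasDerivAt (fun s => ‖n s‖⁻¹ • n s) (‖n t‖⁻¹ • v) t := by
  have hpos : ‖n t‖ ≠ 0 := norm_ne_zero_iff.2 h0
  have hnorm : HasDerivAt (fun s => ‖n s‖) (c * ‖n t‖) t := by
    have h := hn.norm_sq.sqrt (by simpa using h0)
    simp only [Real.sqrt_sq (norm_nonneg _)] at h
    convert h using 1
    rw [inner_add_right, hv, real_inner_smul_right, real_inner_self_eq_norm_sq]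
    field_simp
    ring
  refine ((hnorm.inv hpos).smul hn).congr_deriv ?_
  change ‖n t‖⁻¹ • (v + c • n t) + (-(c * ‖n t‖) / ‖n t‖ ^ 2) • n t = ‖n t‖⁻¹ • v
  rw [smul_add, smul_smul, add_assoc, ← add_smul]
  have hc : ‖n t‖⁻¹ * c + -(c * ‖n t‖) / ‖n t‖ ^ 2 = 0 := by field_simp; ring
  rw [hc, zero_smul, add_zero]

end Normalization

section Rotations

theorem rot_add (g : SO3) (v w : E3) : rot g (v + w) = rot g v + rot g w := by simp [rot]

theorem rot_smul (g : SO3) (c : ℝ) (v : E3) : rot g (c • v) = c • rot g v := by simp [rot]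

theorem rot_sub (g : SO3) (v w : E3) : rot g (v - w) = rot g v - rot g w := by simp [rot]

theorem inner_rot (g : SO3) (v w : E3) : ⟪rot g v, rot g w⟫_ℝ = ⟪v, w⟫_ℝ := by
  have h := norm_rot g (v + w)
  have h1 := norm_add_sq_real v w
  have h2 := norm_add_sq_real (rot g v) (rot g w)
  rw [← rot_add, h, norm_rot, norm_rot] at h2
  linarith

theorem rot_apply (g : SO3) (v : E3) (i : Fin 3) :
    rot g v i = g.1 i 0 * v 0 + g.1 i 1 * v 1 + g.1 i 2 * v 2 := by
  simp [rot, Matrix.toEuclideanLin, Matrix.mulVec, dotProduct, Fin.sum_univ_three]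

theorem inner_rot_cross (g : SO3) (a b c : E3) :
    ⟪rot g a, cross (rot g b) (rot g c)⟫_ℝ = ⟪a, cross b c⟫_ℝ := by
  have hdet : g.1.det = 1 := (Matrix.mem_specialOrthogonalGroup_iff.1 g.2).2
  have h : ⟪rot g a, cross (rot g b) (rot g c)⟫_ℝ = g.1.det * ⟪a, cross b c⟫_ℝ := by
    rw [Matrix.det_fin_three]
    simp only [inner_eq_sum, cross_apply_zero, cross_apply_one, cross_apply_two, rot_apply]
    ring
  rw [h, hdet, one_mul]

theorem rot_cross (g : SO3) (a b : E3) : rot g (cross a b) = cross (rot g a) (rot g b) := by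
  refine ext_inner_left ℝ fun v => ?_
  have hv : v = rot g (rot g⁻¹ v) := by rw [← rot_mul, mul_inv_cancel, rot_one]
  rw [hv, inner_rot, inner_rot_cross]

end Rotations

section ReducedBracket

section LiePoisson

variable {W : Type*} [NormedAddCommGroup W] [NormedSpace ℝ W]

/-- The component in `ℝ³` of the gradient of a linear functional on `ℝ³ × W`. -/
def covectorGrad : (E3 × W →L[ℝ] ℝ) →L[ℝ] E3 :=
  (InnerProductSpace.toDual ℝ E3).symm.toContinuousLinearEquiv.toContinuousLinearMap ∘L
    (ContinuousLinearMap.compL ℝ E3 (E3 × W) ℝ).flip (ContinuousLinearMap.inl ℝ E3 W)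

theorem inner_covectorGrad (α : E3 × W →L[ℝ] ℝ) (a : E3) : ⟪covectorGrad α, a⟫_ℝ = α (a, 0) :=
  InnerProductSpace.toDual_symm_apply

theorem covectorGrad_apply (α : E3 × W →L[ℝ] ℝ) (i : Fin 3) :
    covectorGrad α i = α (EuclideanSpace.single i 1, 0) := by
  rw [← inner_covectorGrad, EuclideanSpace.inner_single_right]
  simp

theorem covector_apply (α : E3 × W →L[ℝ] ℝ) (v : E3 × W) :
    α v = ⟪covectorGrad α, v.1⟫_ℝ + α (0, v.2) := by
  rw [inner_covectorGrad, ← map_add, Prod.mk_add_mk, add_zero, zero_add]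

theorem covectorGrad_comp_snd (l : W →L[ℝ] ℝ) :
    covectorGrad (l ∘L ContinuousLinearMap.snd ℝ E3 W) = 0 :=
  ext_inner_right ℝ fun a => by rw [inner_covectorGrad]; simp

/-- The Lie-Poisson tensor `α ↦ m × ∂α/∂m` of `so(3)*`, extended to `ℝ³ × W`. It is linear in the
base point. -/
def liePoissonTensor : E3 × W →L[ℝ] (E3 × W →L[ℝ] ℝ) →L[ℝ] E3 × W :=
  (ContinuousLinearMap.compL ℝ (E3 × W →L[ℝ] ℝ) E3 (E3 × W)
      (ContinuousLinearMap.inl ℝ E3 W)) ∘L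
    (ContinuousLinearMap.compL ℝ (E3 × W →L[ℝ] ℝ) E3 E3).flip covectorGrad ∘L
      crossL ∘L ContinuousLinearMap.fst ℝ E3 W

theorem liePoissonTensor_apply (y : E3 × W) (α : E3 × W →L[ℝ] ℝ) :
    liePoissonTensor y α = (cross y.1 (covectorGrad α), 0) := rfl

theorem apply_liePoissonTensor (y : E3 × W) (α β : E3 × W →L[ℝ] ℝ) :
    α (liePoissonTensor y β) = -⟪y.1, cross (covectorGrad α) (covectorGrad β)⟫_ℝ := by
  rw [liePoissonTensor_apply, ← inner_covectorGrad, inner_cross_perm, cross_anticomm,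
    inner_neg_right]

theorem schouten_liePoissonTensor (y : E3 × W) (α β γ : E3 × W →L[ℝ] ℝ) :
    α (liePoissonTensor (liePoissonTensor y β) γ) + β (liePoissonTensor (liePoissonTensor y γ) α) +
      γ (liePoissonTensor (liePoissonTensor y α) β) = 0 := by
  rw [apply_liePoissonTensor, apply_liePoissonTensor, apply_liePoissonTensor]
  simp only [liePoissonTensor_apply, inner_eq_sum, cross_apply_zero, cross_apply_one,
    cross_apply_two]
  ring

end LiePoisson

/-- The canonical Poisson tensor `α ↦ (∂α/∂p, -∂α/∂q)` of the `(q, p)`-plane, extended to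
`ℝ³ × ℝ × ℝ`. -/
def canonicalTensor : (V →L[ℝ] ℝ) →L[ℝ] V :=
  (0 : (V →L[ℝ] ℝ) →L[ℝ] E3).prod ((ContinuousLinearMap.apply ℝ ℝ ((0, 0, 1) : V)).prod
    (-ContinuousLinearMap.apply ℝ ℝ ((0, 1, 0) : V)))

theorem apply_canonicalTensor (α β : V →L[ℝ] ℝ) :
    α (canonicalTensor β) = α (0, 1, 0) * β (0, 0, 1) - β (0, 1, 0) * α (0, 0, 1) := by
  have h : canonicalTensor β = β (0, 0, 1) • (0, 1, 0) - β (0, 1, 0) • (0, 0, 1) := by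
    simp [canonicalTensor]
  rw [h, map_sub, map_smul, map_smul, smul_eq_mul, smul_eq_mul, mul_comm (α (0, 1, 0))]

/-- The Poisson tensor of `reducedBracket`; see `reducedBracket_eq_tensorBracket`. -/
def reducedTensor (y : V) : (V →L[ℝ] ℝ) →L[ℝ] V :=
  liePoissonTensor y + canonicalTensor

theorem reducedTensor_apply (y : V) (α : V →L[ℝ] ℝ) :
    reducedTensor y α = (cross y.1 (covectorGrad α), α (0, 0, 1), -α (0, 1, 0)) := by
  simp [reducedTensor, liePoissonTensor_apply, canonicalTensor]

theorem apply_reducedTensor (y : V) (α β : V →L[ℝ] ℝ) :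
    α (reducedTensor y β) = -⟪y.1, cross (covectorGrad α) (covectorGrad β)⟫_ℝ
      + (α (0, 1, 0) * β (0, 0, 1) - β (0, 1, 0) * α (0, 0, 1)) := by
  rw [reducedTensor, add_apply, map_add, apply_liePoissonTensor, apply_canonicalTensor]

theorem isPoissonTensor_reducedTensor : IsPoissonTensor reducedOpens reducedTensor := by
  refine IsPoissonTensor.of_affine (fun y _ α β => ?_) fun y _ α β γ => ?_
  · rw [map_add, map_add, apply_liePoissonTensor, apply_liePoissonTensor, apply_canonicalTensor,
      apply_canonicalTensor, cross_anticomm (covectorGrad β), inner_neg_right]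
    ring
  · have hC (v : V) (α β : V →L[ℝ] ℝ) :
        liePoissonTensor (v + canonicalTensor α) β = liePoissonTensor v β := by
      rw [liePoissonTensor_apply, liePoissonTensor_apply, Prod.fst_add]
      simp [canonicalTensor]
    rw [hC, hC, hC, schouten_liePoissonTensor]

theorem gradM_eq (f : ReducedSpace → ℝ) (y : ReducedSpace) :
    gradM f y = covectorGrad (differential f y) := by
  ext i
  exact (covectorGrad_apply _ i).symm

theorem reducedBracket_eq_tensorBracket : reducedBracket = tensorBracket reducedTensor := by
  funext f h y
  rw [reducedBracket, tensorBracket, apply_reducedTensor, gradM_eq, gradM_eq]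
  rfl

theorem isPoissonBracket_reducedBracket : IsPoissonBracket 𝓘(ℝ, V) reducedBracket := by
  rw [reducedBracket_eq_tensorBracket]
  exact isPoissonTensor_reducedTensor.isPoissonBracket

theorem differential_mCoord (i : Fin 3) (y : ReducedSpace) :
    differential (mCoord i) y =
      EuclideanSpace.proj i ∘L ContinuousLinearMap.fst ℝ E3 (ℝ × ℝ) :=
  differential_comp_val (EuclideanSpace.proj i ∘L ContinuousLinearMap.fst ℝ E3 (ℝ × ℝ)).hasFDerivAt

theorem differential_qCoord (y : ReducedSpace) :
    differential qCoord y =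
      ContinuousLinearMap.fst ℝ ℝ ℝ ∘L ContinuousLinearMap.snd ℝ E3 (ℝ × ℝ) :=
  differential_comp_val
    (ContinuousLinearMap.fst ℝ ℝ ℝ ∘L ContinuousLinearMap.snd ℝ E3 (ℝ × ℝ)).hasFDerivAt

theorem differential_pCoord (y : ReducedSpace) :
    differential pCoord y =
      ContinuousLinearMap.snd ℝ ℝ ℝ ∘L ContinuousLinearMap.snd ℝ E3 (ℝ × ℝ) :=
  differential_comp_val
    (ContinuousLinearMap.snd ℝ ℝ ℝ ∘L ContinuousLinearMap.snd ℝ E3 (ℝ × ℝ)).hasFDerivAt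

theorem reducedBracket_coordinates :
    reducedBracket (mCoord 0) (mCoord 1) = -mCoord 2 ∧
      reducedBracket (mCoord 1) (mCoord 2) = -mCoord 0 ∧
      reducedBracket (mCoord 2) (mCoord 0) = -mCoord 1 ∧
      reducedBracket qCoord pCoord = 1 ∧
      ∀ i, reducedBracket (mCoord i) qCoord = 0 ∧ reducedBracket (mCoord i) pCoord = 0 := by
  rw [reducedBracket_eq_tensorBracket]
  refine ⟨?_, ?_, ?_, ?_, fun i => ⟨?_, ?_⟩⟩
  all_goals
    funext y
    rw [tensorBracket, reducedTensor_apply]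
    simp [differential_mCoord, differential_qCoord, differential_pCoord, cross_apply_zero,
      cross_apply_one, cross_apply_two, covectorGrad_apply, covectorGrad_comp_snd,
      cross_zero_right, mCoord]

theorem isCasimir_norm_sq : IsCasimir 𝓘(ℝ, V) reducedBracket fun y => ‖y.1.1‖ ^ 2 := by
  have hd (y : ReducedSpace) : HasFDerivAt (fun y : V => ‖y.1‖ ^ 2)
      (2 • innerSL ℝ y.1.1 ∘L ContinuousLinearMap.fst ℝ E3 (ℝ × ℝ)) y.1 :=
    hasFDerivAt_fst.norm_sq
  refine ⟨?_, fun f _ => funext fun y => ?_⟩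
  · exact (contDiff_fst.norm_sq ℝ).contMDiff.comp contMDiff_subtype_val
  · rw [reducedBracket_eq_tensorBracket, tensorBracket, differential_comp_val (hd y),
      reducedTensor_apply]
    simp [inner_cross_self_left]

end ReducedBracket

open Function

section Velocities

/-- The inclusion of `Q` into `ℝ³ × ℝ³`, whose differential is `velocity`. -/
def positions (x : Q) : E3 × E3 := (R₁ x, R₂ x)

/-- `velocity`, on the model vector space to which the tangent spaces of `Q` unfold. -/
def velocityModel (x : Q) : ModelSpace →L[ℝ] E3 × E3 := velocity x

theorem contMDiff_positions : ContMDiff modelQ 𝓘(ℝ, E3 × E3) ∞ positions :=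
  contMDiff_R₁.prodMk_space contMDiff_R₂

theorem hasMFDerivAt_positions (x : Q) :
    HasMFDerivAt modelQ 𝓘(ℝ, E3 × E3) positions x (velocityModel x) :=
  (contMDiff_positions.mdifferentiable (by simp) x).hasMFDerivAt

/-- The inclusion of the tangent plane of the sphere into `ℝ³`. -/
def sphereVelocity (y : S2) : EuclideanSpace ℝ (Fin 2) →L[ℝ] E3 :=
  mfderiv (𝓡 2) 𝓘(ℝ, E3) ((↑) : S2 → E3) y

theorem hasMFDerivAt_coe_sphere (y : S2) :
    HasMFDerivAt (𝓡 2) 𝓘(ℝ, E3) ((↑) : S2 → E3) y (sphereVelocity y) :=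
  ((contMDiff_coe_sphere (m := ∞)).mdifferentiable (by simp) y).hasMFDerivAt

theorem sphereVelocity_injective (y : S2) : Injective (sphereVelocity y) :=
  injective_mvfderiv_subtypeVal_sphere y

theorem exists_sphereVelocity_eq_iff (y : S2) (a : E3) :
    (∃ v, sphereVelocity y v = a) ↔ ⟪(y : E3), a⟫_ℝ = 0 := by
  rw [← Submodule.mem_orthogonal_singleton_iff_inner_right, ← range_mvfderiv_subtypeVal (n := 2) y]
  exact Iff.rfl

theorem velocityModel_apply (x : Q) (v : ModelSpace) :
    velocityModel x v = (sphereVelocity x.1.1 v.1, sphereVelocity x.1.2 v.2) := by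
  have h := hasMFDerivAt_subtype_val (I := modelQ) x
  have h₁ := hasMFDerivAt_unique
    ((hasMFDerivAt_coe_sphere x.1.1).comp x ((hasMFDerivAt_fst x.1).comp x h))
    ((ContinuousLinearMap.fst ℝ E3 E3).hasMFDerivAt.comp x (hasMFDerivAt_positions x))
  have h₂ := hasMFDerivAt_unique
    ((hasMFDerivAt_coe_sphere x.1.2).comp x ((hasMFDerivAt_snd x.1).comp x h))
    ((ContinuousLinearMap.snd ℝ E3 E3).hasMFDerivAt.comp x (hasMFDerivAt_positions x))
  exact Prod.ext (congrArg (fun l : ModelSpace →L[ℝ] E3 => l v) h₁).symm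
    (congrArg (fun l : ModelSpace →L[ℝ] E3 => l v) h₂).symm

theorem velocityModel_injective (x : Q) : Injective (velocityModel x) := by
  intro v w h
  rw [velocityModel_apply, velocityModel_apply, Prod.mk.injEq] at h
  exact Prod.ext (sphereVelocity_injective _ h.1) (sphereVelocity_injective _ h.2)

theorem exists_velocityModel_eq_iff (x : Q) (w : E3 × E3) :
    (∃ v, velocityModel x v = w) ↔ ⟪R₁ x, w.1⟫_ℝ = 0 ∧ ⟪R₂ x, w.2⟫_ℝ = 0 := by
  rw [R₁, R₂, ← exists_sphereVelocity_eq_iff, ← exists_sphereVelocity_eq_iff]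
  constructor
  · rintro ⟨v, rfl⟩
    rw [velocityModel_apply]
    exact ⟨⟨_, rfl⟩, ⟨_, rfl⟩⟩
  · rintro ⟨⟨a, ha⟩, ⟨b, hb⟩⟩
    exact ⟨(a, b), by rw [velocityModel_apply, ha, hb]⟩

end Velocities

section Frame

theorem norm_R₁ (x : Q) : ‖R₁ x‖ = 1 := by simp [R₁]

theorem norm_R₂ (x : Q) : ‖R₂ x‖ = 1 := by simp [R₂]

theorem cos_angleQ (x : Q) : Real.cos (angleQ x) = ⟪R₁ x, R₂ x⟫_ℝ := by
  simp [angleQ, InnerProductGeometry.cos_angle, norm_R₁, norm_R₂]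

theorem angleQ_mem_Ioo (x : Q) : angleQ x ∈ Ioo 0 Real.pi := by
  refine ⟨(InnerProductGeometry.angle_nonneg _ _).lt_of_ne' fun h => ?_,
    (InnerProductGeometry.angle_le_pi _ _).lt_of_ne fun h => ?_⟩
  · have hinner : ⟪R₁ x, R₂ x⟫_ℝ = 1 := by rw [← cos_angleQ, angleQ, h, Real.cos_zero]
    exact x.2.1 ((inner_eq_one_iff_of_norm_eq_one (norm_R₁ x) (norm_R₂ x)).1 hinner)
  · have hinner : ⟪R₁ x, R₂ x⟫_ℝ = -1 := by rw [← cos_angleQ, angleQ, h, Real.cos_pi]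
    exact x.2.2 ((inner_eq_neg_one_iff_of_norm_eq_one (norm_R₁ x) (norm_R₂ x)).1 hinner)

theorem sin_angleQ_pos (x : Q) : 0 < Real.sin (angleQ x) :=
  Real.sin_pos_of_mem_Ioo (angleQ_mem_Ioo x)

theorem norm_cross_R (x : Q) : ‖cross (R₂ x) (R₁ x)‖ = Real.sin (angleQ x) := by
  rw [← sq_eq_sq₀ (norm_nonneg _) (sin_angleQ_pos x).le, norm_cross_sq, Real.sin_sq, cos_angleQ,
    norm_R₁, norm_R₂, real_inner_comm]
  ring

theorem cross_R_ne_zero (x : Q) : cross (R₂ x) (R₁ x) ≠ 0 := by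
  rw [← norm_ne_zero_iff, norm_cross_R]
  exact (sin_angleQ_pos x).ne'

theorem bodyFrame_zero (x : Q) :
    bodyFrame x 0 = (Real.sin (angleQ x))⁻¹ • cross (R₂ x) (R₁ x) := by
  rw [← norm_cross_R]; rfl

theorem bodyFrame_one (x : Q) : bodyFrame x 1 = cross (R₁ x) (bodyFrame x 0) := rfl

theorem inner_R₁_self (x : Q) : ⟪R₁ x, R₁ x⟫_ℝ = 1 := by
  rw [real_inner_self_eq_norm_sq, norm_R₁, one_pow]

theorem inner_bodyFrame_zero_self (x : Q) : ⟪bodyFrame x 0, bodyFrame x 0⟫_ℝ = 1 := by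
  have h := (sin_angleQ_pos x).ne'
  rw [bodyFrame_zero, real_inner_smul_left, real_inner_smul_right, real_inner_self_eq_norm_sq,
    norm_cross_R]
  field_simp

theorem inner_R₁_bodyFrame_zero (x : Q) : ⟪R₁ x, bodyFrame x 0⟫_ℝ = 0 := by
  rw [bodyFrame_zero, real_inner_smul_right, cross_anticomm, inner_neg_right, inner_cross_self_left]
  simp

theorem orthonormal_bodyFrame (x : Q) : Orthonormal ℝ (bodyFrame x) := by
  have h00 := inner_bodyFrame_zero_self x
  have h20 := inner_R₁_bodyFrame_zero x
  have h22 := inner_R₁_self x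
  have h11 : ⟪bodyFrame x 1, bodyFrame x 1⟫_ℝ = 1 := by
    rw [bodyFrame_one, inner_cross_cross, h00, h22, h20]; simp
  have h01 : ⟪bodyFrame x 0, bodyFrame x 1⟫_ℝ = 0 := by
    rw [bodyFrame_one, cross_anticomm, inner_neg_right, inner_cross_self_left, neg_zero]
  have h21 : ⟪R₁ x, bodyFrame x 1⟫_ℝ = 0 := inner_cross_self_left _ _
  rw [orthonormal_iff_ite]
  intro i j
  fin_cases i <;> fin_cases j
  exacts [h00, h01, (real_inner_comm _ _).trans h20, (real_inner_comm _ _).trans h01, h11,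
    (real_inner_comm _ _).trans h21, h20, h21, h22]

theorem cross_bodyFrame_one_two (x : Q) : cross (bodyFrame x 1) (R₁ x) = bodyFrame x 0 := by
  rw [cross_anticomm, bodyFrame_one, cross_cross_right, inner_R₁_self, inner_R₁_bodyFrame_zero]
  simp

/-- The rotation that carries the standard frame to the moving frame of a configuration; its
columns are the vectors of the moving frame. -/
def frameRotation (x : Q) : SO3 :=
  ⟨Matrix.of fun i j => bodyFrame x j i, by
    have hortho := orthonormal_iff_ite.1 (orthonormal_bodyFrame x)
    rw [Matrix.mem_specialOrthogonalGroup_iff, Matrix.mem_orthogonalGroup_iff']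
    constructor
    · ext i j
      rw [Matrix.mul_apply, Fin.sum_univ_three, Matrix.one_apply, ← hortho i j, inner_eq_sum]
      rfl
    · have h : ⟪bodyFrame x 0, cross (bodyFrame x 1) (bodyFrame x 2)⟫_ℝ = 1 :=
        (congrArg _ (cross_bodyFrame_one_two x)).trans (hortho 0 0)
      rw [← h, Matrix.det_fin_three]
      simp only [inner_eq_sum, cross_apply_zero, cross_apply_one, cross_apply_two, Matrix.of_apply]
      ring⟩

theorem rot_frameRotation (x : Q) (v : E3) :
    rot (frameRotation x) v = ∑ i, v i • bodyFrame x i := by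
  ext k
  rw [rot_apply]
  simp [frameRotation, Fin.sum_univ_three, mul_comm]

theorem rot_frameRotation_single (x : Q) (i : Fin 3) :
    rot (frameRotation x) (EuclideanSpace.single i 1) = bodyFrame x i := by
  simp [rot_frameRotation, ite_smul]

theorem R₁_eq_rot (x : Q) : R₁ x = rot (frameRotation x) (EuclideanSpace.single 2 1) :=
  (rot_frameRotation_single x 2).symm

/-- The unit vector at angle `q` from `e_z` in the half-plane `y > 0` of the `yz`-plane: the
position of the second body in the moving frame. -/
def meridian (q : ℝ) : E3 :=
  Real.sin q • EuclideanSpace.single 1 1 + Real.cos q • EuclideanSpace.single 2 1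

/-- The velocity of `meridian`. -/
def meridianDeriv (q : ℝ) : E3 :=
  Real.cos q • EuclideanSpace.single 1 1 - Real.sin q • EuclideanSpace.single 2 1

theorem hasDerivAt_meridian (q : ℝ) : HasDerivAt meridian (meridianDeriv q) q := by
  rw [meridianDeriv, sub_eq_add_neg, ← neg_smul]
  exact ((Real.hasDerivAt_sin q).smul_const _).add ((Real.hasDerivAt_cos q).smul_const _)

theorem hasDerivAt_meridianDeriv (q : ℝ) : HasDerivAt meridianDeriv (-meridian q) q := by
  rw [meridian, neg_add, ← neg_smul, ← sub_eq_add_neg]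
  exact ((Real.hasDerivAt_cos q).smul_const _).sub ((Real.hasDerivAt_sin q).smul_const _)

theorem R₂_eq_rot (x : Q) : R₂ x = rot (frameRotation x) (meridian (angleQ x)) := by
  have h : Real.sin (angleQ x) • bodyFrame x 1 + Real.cos (angleQ x) • R₁ x = R₂ x := by
    rw [bodyFrame_one, bodyFrame_zero, cross_smul_right, cross_cross_right,
      smul_inv_smul₀ (sin_angleQ_pos x).ne', cos_angleQ, inner_R₁_self]
    simp
  rw [← h, rot_frameRotation, Fin.sum_univ_three]
  simp [meridian, bodyFrame]

end Frame

section ChartLines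

variable {E : Type*} [NormedAddCommGroup E] [NormedSpace ℝ E]
  {H : Type*} [TopologicalSpace H] (I : ModelWithCorners ℝ E H)
  {M : Type*} [TopologicalSpace M] [ChartedSpace H M]

/-- The curve through `x` that is, in the preferred chart at `x`, a straight line with velocity
`v`. Differentiation along it computes differentials at `x`. -/
def chartLine (x : M) (v : E) (t : ℝ) : M :=
  (extChartAt I x).symm (extChartAt I x x + t • v)

theorem chartLine_zero (x : M) (v : E) : chartLine I x v 0 = x := by
  simp [chartLine]

variable {I} {F : Type*} [NormedAddCommGroup F] [NormedSpace ℝ F]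

theorem hasDerivAt_comp_chartLine [I.Boundaryless] {f : M → F} {x : M} {L : E →L[ℝ] F}
    (hf : HasMFDerivAt I 𝓘(ℝ, F) f x L) (v : E) :
    HasDerivAt (fun t => f (chartLine I x v t)) (L v) 0 := by
  have hline : HasDerivAt (fun t : ℝ => extChartAt I x x + t • v) v 0 := by
    simpa using ((hasDerivAt_id (0 : ℝ)).smul_const v).const_add (extChartAt I x x)
  have h := hasFDerivAt_comp_extChartAt_symm hf
  rw [← add_zero (extChartAt I x x), ← zero_smul ℝ v] at h
  exact h.comp_hasDerivAt (0 : ℝ) hline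

end ChartLines

section BodyVelocities

theorem inner_meridian_meridianDeriv (q : ℝ) : ⟪meridian q, meridianDeriv q⟫_ℝ = 0 := by
  simp [meridian, meridianDeriv, inner_eq_sum, mul_comm]

/-- The velocities `(ω × R₁, ω × R₂ + s u)` of the two bodies when the configuration rotates with
angular velocity `ω`, which has components `a` in the moving frame, and the second body moreover
opens the angle at rate `s` in the direction `u = cos q e_y - sin q e_z`. -/
def bodyVelocity (x : Q) : E3 × ℝ →ₗ[ℝ] E3 × E3 where
  toFun w := (rot (frameRotation x) (cross w.1 (EuclideanSpace.single 2 1)),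
    rot (frameRotation x)
      (cross w.1 (meridian (angleQ x)) + w.2 • meridianDeriv (angleQ x)))
  map_add' w w' := by
    simp only [Prod.fst_add, Prod.snd_add, Prod.mk_add_mk, ← rot_add, cross_add_left, add_smul,
      add_add_add_comm]
  map_smul' c w := by
    simp only [Prod.smul_fst, Prod.smul_snd, Prod.smul_mk, ← rot_smul, cross_smul_left, smul_add,
      smul_smul, smul_eq_mul, RingHom.id_apply]

theorem bodyVelocity_apply (x : Q) (w : E3 × ℝ) : bodyVelocity x w =
    (rot (frameRotation x) (cross w.1 (EuclideanSpace.single 2 1)),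
      rot (frameRotation x)
        (cross w.1 (meridian (angleQ x)) + w.2 • meridianDeriv (angleQ x))) := rfl

theorem eq_zero_of_rot_eq_zero {g : SO3} {v : E3} (h : rot g v = 0) : v = 0 :=
  norm_eq_zero.1 ((norm_rot g v).symm.trans (norm_eq_zero.2 h))

theorem bodyVelocity_injective (x : Q) : Injective (bodyVelocity x) := by
  refine (injective_iff_map_eq_zero _).2 fun ⟨a, s⟩ h => ?_
  have h₁ := eq_zero_of_rot_eq_zero (congrArg Prod.fst h)
  have h₂ := eq_zero_of_rot_eq_zero (congrArg Prod.snd h)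
  have hsin := (sin_angleQ_pos x).ne'
  have ha₀ : a 0 = 0 := by simpa [cross_apply_one] using congrArg (fun v : E3 => v 1) h₁
  have ha₁ : a 1 = 0 := by simpa [cross_apply_zero] using congrArg (fun v : E3 => v 0) h₁
  have ha₂ : a 2 = 0 := by
    simpa [cross_apply_zero, meridian, meridianDeriv, ha₁, hsin] using
      congrArg (fun v : E3 => v 0) h₂
  have hs : s = 0 := by
    simpa [cross_apply_two, meridian, meridianDeriv, ha₀, ha₁, hsin] using
      congrArg (fun v : E3 => v 2) h₂
  have ha : a = 0 := by ext i; fin_cases i <;> assumption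
  rw [ha, hs, Prod.mk_zero_zero]

theorem exists_velocityModel_eq_bodyVelocity (x : Q) (w : E3 × ℝ) :
    ∃ v, velocityModel x v = bodyVelocity x w := by
  rw [exists_velocityModel_eq_iff, R₁_eq_rot, R₂_eq_rot, bodyVelocity_apply, inner_rot, inner_rot]
  constructor
  · rw [cross_anticomm, inner_neg_right, inner_cross_self_left, neg_zero]
  · rw [inner_add_right, cross_anticomm, inner_neg_right, inner_cross_self_left,
      real_inner_smul_right, inner_meridian_meridianDeriv]
    simp

theorem exists_linearEquiv_velocityModel_eq (x : Q) :
    ∃ e : (E3 × ℝ) ≃ₗ[ℝ] ModelSpace, ∀ w, velocityModel x (e w) = bodyVelocity x w := by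
  obtain ⟨L, hL⟩ := LinearMap.exists_leftInverse_of_injective
    (velocityModel x : ModelSpace →ₗ[ℝ] E3 × E3)
    (LinearMap.ker_eq_bot.2 (velocityModel_injective x))
  have hvel : ∀ w, velocityModel x (L (bodyVelocity x w)) = bodyVelocity x w := by
    intro w
    obtain ⟨v, hv⟩ := exists_velocityModel_eq_bodyVelocity x w
    rw [← hv]
    exact congrArg (velocityModel x) (LinearMap.congr_fun hL v)
  have hinj : Injective (L ∘ₗ bodyVelocity x) := fun w w' h => bodyVelocity_injective x <| by
    rw [← hvel w, ← hvel w']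
    exact congrArg (velocityModel x) h
  exact ⟨LinearMap.linearEquivOfInjective _ hinj (by simp [Module.finrank_prod]), hvel⟩

/-- The tangent vector of `Q` with given components of the angular velocity in the moving frame and
given opening rate of the angle. -/
def bodyTangent (x : Q) : (E3 × ℝ) ≃ₗ[ℝ] ModelSpace :=
  (exists_linearEquiv_velocityModel_eq x).choose

theorem velocityModel_bodyTangent (x : Q) (w : E3 × ℝ) :
    velocityModel x (bodyTangent x w) = bodyVelocity x w :=
  (exists_linearEquiv_velocityModel_eq x).choose_spec w

/-- `bodyTangent` as a family of vector fields on `Q`. -/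
def bodyField (w : E3 × ℝ) (x : Q) : TangentSpace modelQ x := bodyTangent x w

end BodyVelocities

section Kinematics

variable {γ : ℝ → Q} {w : E3 × ℝ} {t : ℝ}

theorem hasDerivAt_R₁ (hγ : HasDerivAt (fun τ => positions (γ τ)) (bodyVelocity (γ t) w) t) :
    HasDerivAt (fun τ => R₁ (γ τ))
      (rot (frameRotation (γ t)) (cross w.1 (EuclideanSpace.single 2 1))) t :=
  (ContinuousLinearMap.fst ℝ E3 E3).hasFDerivAt.comp_hasDerivAt t hγ

theorem hasDerivAt_R₂ (hγ : HasDerivAt (fun τ => positions (γ τ)) (bodyVelocity (γ t) w) t) :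
    HasDerivAt (fun τ => R₂ (γ τ))
      (rot (frameRotation (γ t))
        (cross w.1 (meridian (angleQ (γ t))) + w.2 • meridianDeriv (angleQ (γ t)))) t :=
  (ContinuousLinearMap.snd ℝ E3 E3).hasFDerivAt.comp_hasDerivAt t hγ

theorem angleQ_eq_arccos (x : Q) : angleQ x = Real.arccos ⟪R₁ x, R₂ x⟫_ℝ := by
  rw [← cos_angleQ, Real.arccos_cos (angleQ_mem_Ioo x).1.le (angleQ_mem_Ioo x).2.le]

theorem inner_R₁_R₂_ne (x : Q) : ⟪R₁ x, R₂ x⟫_ℝ ≠ -1 ∧ ⟪R₁ x, R₂ x⟫_ℝ ≠ 1 := by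
  have h := sin_angleQ_pos x
  have hsq := Real.sin_sq_add_cos_sq (angleQ x)
  rw [← cos_angleQ]
  constructor <;> intro hc <;> rw [hc] at hsq <;> nlinarith

theorem hasDerivAt_angleQ (hγ : HasDerivAt (fun τ => positions (γ τ)) (bodyVelocity (γ t) w) t) :
    HasDerivAt (fun τ => angleQ (γ τ)) w.2 t := by
  have hcos : HasDerivAt (fun τ => ⟪R₁ (γ τ), R₂ (γ τ)⟫_ℝ)
      (-(w.2 * Real.sin (angleQ (γ t)))) t := by
    refine ((hasDerivAt_R₁ hγ).inner ℝ (hasDerivAt_R₂ hγ)).congr_deriv ?_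
    rw [R₁_eq_rot, R₂_eq_rot, inner_rot, inner_rot]
    simp [inner_eq_sum, cross_apply_zero, cross_apply_one, cross_apply_two, meridian, meridianDeriv]
  have hsin := sin_angleQ_pos (γ t)
  have hne := inner_R₁_R₂_ne (γ t)
  simp only [angleQ_eq_arccos]
  refine ((Real.hasDerivAt_arccos hne.1 hne.2).comp t hcos).congr_deriv ?_
  rw [← cos_angleQ, ← Real.sin_sq, Real.sqrt_sq hsin.le]
  field_simp

theorem hasDerivAt_bodyFrame (hγ : HasDerivAt (fun τ => positions (γ τ)) (bodyVelocity (γ t) w) t)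
    (i : Fin 3) : HasDerivAt (fun τ => bodyFrame (γ τ) i)
      (rot (frameRotation (γ t)) (cross w.1 (EuclideanSpace.single i 1))) t := by
  set q := angleQ (γ t) with hq
  set g := frameRotation (γ t)
  have hsin : Real.sin q ≠ 0 := (sin_angleQ_pos (γ t)).ne'
  have hzero : HasDerivAt (fun τ => bodyFrame (γ τ) 0)
      (rot g (cross w.1 (EuclideanSpace.single 0 1))) t := by
    have hnormal : cross (R₂ (γ t)) (R₁ (γ t)) =
        rot g (Real.sin q • EuclideanSpace.single 0 1) := by
      rw [rot_smul, rot_frameRotation_single, bodyFrame_zero, smul_inv_smul₀ hsin]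
    have hn := hasDerivAt_cross (hasDerivAt_R₂ hγ) (hasDerivAt_R₁ hγ)
    have h := hasDerivAt_normalize (v := Real.sin q • rot g (cross w.1 (EuclideanSpace.single 0 1)))
      (c := w.2 * Real.cos q / Real.sin q) (hn.congr_deriv ?_) (cross_R_ne_zero _) ?_
    · simpa only [bodyFrame_zero, norm_cross_R, ← hq, inv_smul_smul₀ hsin] using h
    · rw [hnormal, R₁_eq_rot, R₂_eq_rot, ← rot_cross, ← rot_cross, ← rot_smul, ← rot_smul,
        ← rot_add, ← rot_add, smul_smul, div_mul_cancel₀ _ hsin]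
      congr 1
      ext i
      fin_cases i <;>
        simp [cross_apply_zero, cross_apply_one, cross_apply_two, meridian, meridianDeriv, ← hq] <;>
        ring
    · rw [hnormal, ← rot_smul, inner_rot, cross_anticomm]
      simp [real_inner_smul_left, real_inner_smul_right, inner_cross_self_left]
  fin_cases i
  · exact hzero
  · refine (hasDerivAt_cross (hasDerivAt_R₁ hγ) hzero).congr_deriv ?_
    rw [← rot_frameRotation_single, R₁_eq_rot, ← rot_cross, ← rot_cross, ← rot_add]
    congr 1
    ext i
    fin_cases i <;> simp [cross_apply_zero, cross_apply_one, cross_apply_two]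
  · exact hasDerivAt_R₁ hγ

theorem hasDerivAt_rot_frameRotation
    (hγ : HasDerivAt (fun τ => positions (γ τ)) (bodyVelocity (γ t) w) t) {v : ℝ → E3} {v' : E3}
    (hv : HasDerivAt v v' (angleQ (γ t))) :
    HasDerivAt (fun τ => rot (frameRotation (γ τ)) (v (angleQ (γ τ))))
      (rot (frameRotation (γ t)) (cross w.1 (v (angleQ (γ t))) + w.2 • v')) t := by
  have hcoord (i : Fin 3) : HasDerivAt (fun τ => v (angleQ (γ τ)) i) (w.2 * v' i) t := by
    have hvi : HasDerivAt (fun q => v q i) (v' i) (angleQ (γ t)) :=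
      (EuclideanSpace.proj (𝕜 := ℝ) i).hasFDerivAt.comp_hasDerivAt _ hv
    exact hvi.scomp t (hasDerivAt_angleQ hγ)
  simp only [rot_frameRotation]
  refine (HasDerivAt.fun_sum fun i _ =>
    (hcoord i).smul (hasDerivAt_bodyFrame hγ i)).congr_deriv ?_
  simp only [← rot_frameRotation_single, ← rot_smul, ← rot_add, Fin.sum_univ_three]
  congr 1
  ext i
  fin_cases i <;> simp [cross_apply_zero, cross_apply_one, cross_apply_two] <;> ring

/-- The derivative of `bodyVelocity · w'` in the direction of `bodyTangent x w`. -/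
def bodyAcceleration (x : Q) (w w' : E3 × ℝ) : E3 × E3 :=
  (rot (frameRotation x) (cross w.1 (cross w'.1 (EuclideanSpace.single 2 1))),
    rot (frameRotation x)
      (cross w.1 (cross w'.1 (meridian (angleQ x)) + w'.2 • meridianDeriv (angleQ x))
        + w.2 • (cross w'.1 (meridianDeriv (angleQ x)) - w'.2 • meridian (angleQ x))))

theorem hasDerivAt_bodyVelocity
    (hγ : HasDerivAt (fun τ => positions (γ τ)) (bodyVelocity (γ t) w) t) (w' : E3 × ℝ) :
    HasDerivAt (fun τ => bodyVelocity (γ τ) w') (bodyAcceleration (γ t) w w') t := by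
  have h₁ := hasDerivAt_rot_frameRotation hγ
    (hasDerivAt_const (angleQ (γ t)) (cross w'.1 (EuclideanSpace.single 2 1)))
  have h₂ := hasDerivAt_rot_frameRotation hγ
    (((crossL w'.1).hasFDerivAt.comp_hasDerivAt _ (hasDerivAt_meridian (angleQ (γ t)))).add
      ((hasDerivAt_meridianDeriv (angleQ (γ t))).const_smul w'.2))
  rw [smul_zero, add_zero] at h₁
  rw [smul_neg, ← sub_eq_add_neg] at h₂
  exact h₁.prodMk h₂

theorem bodyAcceleration_sub (x : Q) (w w' : E3 × ℝ) :
    bodyAcceleration x w w' - bodyAcceleration x w' w = bodyVelocity x (cross w.1 w'.1, 0) := by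
  simp only [bodyAcceleration, bodyVelocity_apply, Prod.mk_sub_mk, ← rot_sub, cross_cross,
    zero_smul, add_zero, cross_add_right, cross_smul_right, smul_sub, smul_smul]
  congr 2
  rw [mul_comm w'.2]
  abel

end Kinematics

section Smoothness

theorem contMDiff_angleQ : ContMDiff modelQ 𝓘(ℝ, ℝ) ∞ angleQ := by
  have hinner : ContMDiff modelQ 𝓘(ℝ, ℝ) ∞ fun x => ⟪R₁ x, R₂ x⟫_ℝ :=
    contDiff_inner.contMDiff.comp contMDiff_positions
  rw [funext angleQ_eq_arccos]
  exact fun x => ContMDiffAt.comp (g := Real.arccos) x (Real.contDiffAt_arccos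
    (inner_R₁_R₂_ne x).1 (inner_R₁_R₂_ne x).2).contMDiffAt (hinner x)

theorem contMDiff_cross {E : Type*} [NormedAddCommGroup E] [NormedSpace ℝ E]
    {H : Type*} [TopologicalSpace H] {I : ModelWithCorners ℝ E H}
    {M : Type*} [TopologicalSpace M] [ChartedSpace H M] {n : ℕ∞ω} {f g : M → E3}
    (hf : ContMDiff I 𝓘(ℝ, E3) n f) (hg : ContMDiff I 𝓘(ℝ, E3) n g) :
    ContMDiff I 𝓘(ℝ, E3) n fun x => cross (f x) (g x) :=
  (crossL.contMDiff.comp hf).clm_apply hg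

theorem contMDiff_bodyFrame (i : Fin 3) :
    ContMDiff modelQ 𝓘(ℝ, E3) ∞ fun x => bodyFrame x i := by
  have hzero : ContMDiff modelQ 𝓘(ℝ, E3) ∞ fun x => bodyFrame x 0 := by
    simp only [bodyFrame_zero]
    have hsin : ContMDiff modelQ 𝓘(ℝ, ℝ) ∞ fun x => Real.sin (angleQ x) :=
      Real.contDiff_sin.contMDiff.comp contMDiff_angleQ
    exact (hsin.inv₀ fun x => (sin_angleQ_pos x).ne').smul
      (contMDiff_cross contMDiff_R₂ contMDiff_R₁)
  fin_cases i
  · exact hzero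
  · exact contMDiff_cross contMDiff_R₁ hzero
  · exact contMDiff_R₁

theorem contMDiff_rot_frameRotation {v : ℝ → E3} (hv : ContDiff ℝ ∞ v) :
    ContMDiff modelQ 𝓘(ℝ, E3) ∞ fun x => rot (frameRotation x) (v (angleQ x)) := by
  simp only [rot_frameRotation]
  exact contMDiff_finsetSum fun i _ =>
    (((contDiff_euclidean.1 hv i).contMDiff).comp contMDiff_angleQ).smul (contMDiff_bodyFrame i)

theorem contDiff_meridian : ContDiff ℝ ∞ meridian :=
  (Real.contDiff_sin.smul contDiff_const).add (Real.contDiff_cos.smul contDiff_const)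

theorem contDiff_meridianDeriv : ContDiff ℝ ∞ meridianDeriv :=
  (Real.contDiff_cos.smul contDiff_const).sub (Real.contDiff_sin.smul contDiff_const)

theorem contDiff_cross_meridian_add_smul (w : E3 × ℝ) :
    ContDiff ℝ ∞ fun q => cross w.1 (meridian q) + w.2 • meridianDeriv q :=
  ((crossL w.1).contDiff.comp contDiff_meridian).add (contDiff_meridianDeriv.const_smul w.2)

theorem contMDiff_bodyVelocity (w : E3 × ℝ) :
    ContMDiff modelQ 𝓘(ℝ, E3 × E3) ∞ fun x => bodyVelocity x w := by
  have h₁ := contMDiff_rot_frameRotation (v := fun _ => cross w.1 (EuclideanSpace.single 2 1))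
    contDiff_const
  have h₂ := contMDiff_rot_frameRotation (contDiff_cross_meridian_add_smul w)
  exact h₁.prodMk_space h₂

end Smoothness

section BodyFields

open VectorField

theorem contMDiff_bodyField (w : E3 × ℝ) :
    ContMDiff modelQ modelQ.tangent ∞ (T% (bodyField w)) :=
  contMDiff_of_mfderiv_apply contMDiff_positions velocityModel_injective
    (fun x => velocityModel_bodyTangent x w) (contMDiff_bodyVelocity w)

theorem mdiffAt_bodyField (w : E3 × ℝ) (x : Q) :
    MDifferentiableAt modelQ modelQ.tangent (T% (bodyField w)) x :=
  (contMDiff_bodyField w).mdifferentiable (by simp) x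

theorem hasDerivAt_positions_chartLine (x : Q) (w : E3 × ℝ) :
    HasDerivAt (fun t => positions (chartLine modelQ x (bodyTangent x w) t))
      (bodyVelocity (chartLine modelQ x (bodyTangent x w) 0) w) 0 := by
  rw [chartLine_zero, ← velocityModel_bodyTangent]
  exact hasDerivAt_comp_chartLine (hasMFDerivAt_positions x) _

/-- The differential of the angle between the bodies. -/
def angleDifferential (x : Q) : ModelSpace →L[ℝ] ℝ := mfderiv modelQ 𝓘(ℝ, ℝ) angleQ x

theorem hasMFDerivAt_angleQ (x : Q) :
    HasMFDerivAt modelQ 𝓘(ℝ, ℝ) angleQ x (angleDifferential x) :=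
  (contMDiff_angleQ.mdifferentiable (by simp) x).hasMFDerivAt

theorem angleDifferential_bodyTangent (x : Q) (w : E3 × ℝ) :
    angleDifferential x (bodyTangent x w) = w.2 :=
  (hasDerivAt_comp_chartLine (hasMFDerivAt_angleQ x) _).unique
    (hasDerivAt_angleQ (hasDerivAt_positions_chartLine x w))

theorem mfderiv_bodyVelocity (w w' : E3 × ℝ) (x : Q) :
    (mfderiv modelQ 𝓘(ℝ, E3 × E3) (fun y => bodyVelocity y w') x : ModelSpace →L[ℝ] E3 × E3)
      (bodyTangent x w) = bodyAcceleration x w w' := by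
  have h := (hasDerivAt_comp_chartLine
    ((contMDiff_bodyVelocity w').mdifferentiable (by simp) x).hasMFDerivAt _).unique
      (hasDerivAt_bodyVelocity (hasDerivAt_positions_chartLine x w) w')
  rwa [chartLine_zero] at h

theorem mlieBracket_bodyField (w w' : E3 × ℝ) (x : Q) :
    mlieBracket modelQ (bodyField w) (bodyField w') x = bodyTangent x (cross w.1 w'.1, 0) := by
  have hmf (w : E3 × ℝ) := ((contMDiff_bodyVelocity w).mdifferentiable (by simp) x).hasMFDerivAt
  apply velocityModel_injective x
  refine (mfderiv_mlieBracket contMDiff_positions (mdiffAt_bodyField w x) (mdiffAt_bodyField w' x)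
    (fun y => velocityModel_bodyTangent y w) (fun y => velocityModel_bodyTangent y w')
    (hmf w) (hmf w')).trans ?_
  rw [velocityModel_bodyTangent, ← bodyAcceleration_sub]
  exact congrArg₂ _ (mfderiv_bodyVelocity w w' x) (mfderiv_bodyVelocity w' w x)

end BodyFields

section Equivariance

theorem eq_of_R_eq {x y : Q} (h₁ : R₁ x = R₁ y) (h₂ : R₂ x = R₂ y) : x = y :=
  Subtype.ext (Prod.ext (Subtype.ext h₁) (Subtype.ext h₂))

variable (g : SO3) (x : Q)

theorem angleQ_smul : angleQ (g • x) = angleQ x := by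
  rw [angleQ_eq_arccos, R₁_smul, R₂_smul, inner_rot, ← angleQ_eq_arccos]

theorem bodyFrame_smul (i : Fin 3) : bodyFrame (g • x) i = rot g (bodyFrame x i) := by
  have hzero : bodyFrame (g • x) 0 = rot g (bodyFrame x 0) := by
    rw [bodyFrame_zero, bodyFrame_zero, angleQ_smul, R₁_smul, R₂_smul, rot_smul, rot_cross]
  fin_cases i
  · exact hzero
  · exact (congrArg (cross (R₁ (g • x))) hzero).trans (rot_cross g _ _).symm
  · rfl

theorem rot_frameRotation_smul (v : E3) :
    rot (frameRotation (g • x)) v = rot g (rot (frameRotation x) v) := by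
  simp only [rot_frameRotation, bodyFrame_smul, Fin.sum_univ_three, rot_add, rot_smul]

theorem bodyVelocity_smul (w : E3 × ℝ) : bodyVelocity (g • x) w =
    (rot g (bodyVelocity x w).1, rot g (bodyVelocity x w).2) := by
  simp only [bodyVelocity_apply, angleQ_smul, rot_frameRotation_smul]

/-- The rotation of a pair of vectors. -/
def rotPair : E3 × E3 →L[ℝ] E3 × E3 :=
  let R := LinearMap.toContinuousLinearMap
    (Matrix.toEuclideanLin (g : Matrix (Fin 3) (Fin 3) ℝ))
  R.prodMap R

theorem rotPair_apply (u : E3 × E3) : rotPair g u = (rot g u.1, rot g u.2) := rfl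

theorem velocityModel_dSmulModel (v : ModelSpace) :
    velocityModel (g • x) (dSmulModel g x v) = rotPair g (velocityModel x v) := by
  have h₁ := (hasMFDerivAt_positions (g • x)).comp x (hasMFDerivAt_smul g x)
  have h₂ := (rotPair g).hasMFDerivAt.comp x (hasMFDerivAt_positions x)
  exact congrArg (fun l : ModelSpace →L[ℝ] E3 × E3 => l v) (hasMFDerivAt_unique h₁ h₂)

theorem dSmulModel_bodyTangent (w : E3 × ℝ) :
    dSmulModel g x (bodyTangent x w) = bodyTangent (g • x) w := by
  apply velocityModel_injective
  rw [velocityModel_dSmulModel, velocityModel_bodyTangent, velocityModel_bodyTangent,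
    bodyVelocity_smul, rotPair_apply]

variable {x} in
theorem exists_smul_eq {y : Q} (h : angleQ x = angleQ y) : ∃ g : SO3, g • x = y := by
  have hrot (v : E3) : rot (frameRotation y * (frameRotation x)⁻¹) (rot (frameRotation x) v) =
      rot (frameRotation y) v := by rw [← rot_mul, inv_mul_cancel_right]
  refine ⟨frameRotation y * (frameRotation x)⁻¹, eq_of_R_eq ?_ ?_⟩
  · rw [R₁_smul, R₁_eq_rot x, R₁_eq_rot y, hrot]
  · rw [R₂_smul, R₂_eq_rot x, R₂_eq_rot y, hrot, h]

theorem exists_angleQ_eq {q : ℝ} (hq : q ∈ Ioo 0 Real.pi) : ∃ x : Q, angleQ x = q := by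
  have hsin := Real.sin_pos_of_mem_Ioo hq
  have hcoord : meridian q 1 = Real.sin q := by simp [meridian]
  have hnorm : ‖meridian q‖ = 1 := by
    rw [← sq_eq_sq₀ (norm_nonneg _) zero_le_one, ← real_inner_self_eq_norm_sq, inner_eq_sum]
    simp [meridian, ← sq]
  refine ⟨⟨(⟨EuclideanSpace.single 2 1, by simp⟩, ⟨meridian q, by simpa using hnorm⟩), ?_, ?_⟩, ?_⟩
  · intro h
    have h₁ := congrArg (fun v : E3 => v 1) h
    simp only [hcoord] at h₁
    exact hsin.ne (by simpa using h₁)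
  · intro h
    have h₁ := congrArg (fun v : E3 => v 1) h
    simp only [PiLp.neg_apply, hcoord] at h₁
    exact hsin.ne' (by simpa using h₁)
  · refine (angleQ_eq_arccos _).trans
      ((congrArg Real.arccos ?_).trans (Real.arccos_cos hq.1.le hq.2.le))
    simp [R₁, R₂, inner_eq_sum, meridian]

end Equivariance

section BodyMomentum

theorem contMDiff_of_apply {G F : Type*} [NormedAddCommGroup G] [NormedSpace ℝ G]
    [FiniteDimensional ℝ G] [NormedAddCommGroup F] [NormedSpace ℝ F]
    {E : Type*} [NormedAddCommGroup E] [NormedSpace ℝ E]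
    {H : Type*} [TopologicalSpace H] {I : ModelWithCorners ℝ E H}
    {M : Type*} [TopologicalSpace M] [ChartedSpace H M] {n : ℕ∞ω} {L : M → G →L[ℝ] F}
    (hL : ∀ v, ContMDiff I 𝓘(ℝ, F) n fun x => L x v) : ContMDiff I 𝓘(ℝ, G →L[ℝ] F) n L := by
  let b := Module.finBasis ℝ G
  let coord (i) : G →L[ℝ] ℝ := LinearMap.toContinuousLinearMap (b.coord i)
  have hsum : L = fun x => ∑ i, ContinuousLinearMap.smulRightL ℝ G F (coord i) (L x (b i)) := by
    funext x
    ext v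
    conv_lhs => rw [← b.sum_repr v, map_sum]
    simp [coord]
  rw [hsum]
  exact contMDiff_finsetSum fun i _ =>
    (ContinuousLinearMap.smulRightL ℝ G F (coord i)).contMDiff.comp (hL (b i))

/-- The covector of a point of `T*Q`, on the model vector space. -/
def modelCovector (z : TStarQ) : ModelSpace →L[ℝ] ℝ := z.2

theorem modelCovector_smul (g : SO3) (z : TStarQ) (v : ModelSpace) :
    modelCovector (g • z) (dSmulModel g z.proj v) = modelCovector z v := by
  obtain ⟨e, he⟩ := dSmul_isInvertible g z.proj
  have h : modelCovector (g • z) = modelCovector z ∘L (dSmulModel g z.proj).inverse := rfl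
  rw [h, ← he, ContinuousLinearMap.inverse_equiv]
  exact congrArg (modelCovector z) (e.symm_apply_apply v)

/-- The components of a covector in the moving frame: its values on the vectors `bodyTangent`. -/
def bodyCovector (z : TStarQ) : E3 × ℝ →L[ℝ] ℝ :=
  modelCovector z ∘L (bodyTangent z.proj).toContinuousLinearEquiv

theorem bodyCovector_apply (z : TStarQ) (w : E3 × ℝ) :
    bodyCovector z w = modelCovector z (bodyTangent z.proj w) := rfl

theorem contMDiff_bodyCovector :
    ContMDiff modelTStarQ 𝓘(ℝ, E3 × ℝ →L[ℝ] ℝ) ∞ bodyCovector :=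
  contMDiff_of_apply fun w => contMDiff_momentumFun (contMDiff_bodyField w)

theorem bodyCovector_smul (g : SO3) (z : TStarQ) : bodyCovector (g • z) = bodyCovector z :=
  ContinuousLinearMap.ext fun w => by
    rw [bodyCovector_apply z, ← modelCovector_smul g, dSmulModel_bodyTangent]
    rfl

theorem eq_of_bodyCovector_eq {z z' : TStarQ} (hproj : z.proj = z'.proj)
    (h : bodyCovector z = bodyCovector z') : z = z' := by
  obtain ⟨x, α⟩ := z
  obtain ⟨x', α'⟩ := z'
  obtain rfl : x = x' := hproj
  have hα : modelCovector ⟨x, α⟩ = modelCovector ⟨x, α'⟩ := ContinuousLinearMap.ext fun v => by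
    simpa only [bodyCovector_apply, LinearEquiv.apply_symm_apply] using
      congrArg (fun l : E3 × ℝ →L[ℝ] ℝ => l ((bodyTangent x).symm v)) h
  exact congrArg (TotalSpace.mk x) hα

theorem exists_bodyCovector_eq (x : Q) (α : E3 × ℝ →L[ℝ] ℝ) :
    ∃ z : TStarQ, z.proj = x ∧ bodyCovector z = α := by
  let β : ModelSpace →L[ℝ] ℝ := α ∘L (bodyTangent x).symm.toContinuousLinearEquiv
  refine ⟨⟨x, β⟩, rfl, ContinuousLinearMap.ext fun w => ?_⟩
  exact congrArg α ((bodyTangent x).symm_apply_apply w)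

end BodyMomentum

section Reduction

/-- The reduction map `α ↦ (m, q, p)`, with values in `ℝ³ × ℝ × ℝ`. -/
def reduceVec (z : TStarQ) : V :=
  (covectorGrad (bodyCovector z), angleQ z.proj, bodyCovector z (0, 1))

theorem contMDiff_angleQ_proj :
    ContMDiff modelTStarQ 𝓘(ℝ, ℝ) ∞ fun z : TStarQ => angleQ z.proj :=
  contMDiff_angleQ.comp (contMDiff_proj _)

theorem contMDiff_reduceVec : ContMDiff modelTStarQ 𝓘(ℝ, V) ∞ reduceVec :=
  (covectorGrad.contMDiff.comp contMDiff_bodyCovector).prodMk_space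
    (contMDiff_angleQ_proj.prodMk_space
      (contMDiff_momentumFun (contMDiff_bodyField ((0, 1) : E3 × ℝ))))

theorem reduceVec_smul (g : SO3) (z : TStarQ) : reduceVec (g • z) = reduceVec z := by
  have hangle : angleQ (g • z).proj = angleQ z.proj := angleQ_smul g z.proj
  rw [reduceVec, reduceVec, bodyCovector_smul, hangle]

theorem bodyCovector_eq_reduceVec (z : TStarQ) (w : E3 × ℝ) :
    bodyCovector z w = ⟪(reduceVec z).1, w.1⟫_ℝ + w.2 * (reduceVec z).2.2 := by
  rw [covector_apply, reduceVec, ← smul_eq_mul, ← map_smul, Prod.smul_mk, smul_zero, smul_eq_mul,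
    mul_one]

theorem reduceVec_eq_iff {z z' : TStarQ} :
    reduceVec z = reduceVec z' ↔ MulAction.orbitRel SO3 TStarQ z z' := by
  rw [MulAction.orbitRel_apply, MulAction.mem_orbit_iff]
  constructor
  · intro h
    obtain ⟨g, hg⟩ := exists_smul_eq (congrArg (fun v : V => v.2.1) h).symm
    refine ⟨g, eq_of_bodyCovector_eq hg (ContinuousLinearMap.ext fun w => ?_)⟩
    rw [bodyCovector_smul, bodyCovector_eq_reduceVec, bodyCovector_eq_reduceVec, h]
  · rintro ⟨g, rfl⟩
    exact reduceVec_smul g z'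

theorem exists_reduceVec_eq {v : V} (hv : v.2.1 ∈ Ioo 0 Real.pi) : ∃ z, reduceVec z = v := by
  obtain ⟨x, hx⟩ := exists_angleQ_eq hv
  obtain ⟨z, rfl, hα⟩ := exists_bodyCovector_eq x
    ((innerSL ℝ v.1).coprod (v.2.2 • ContinuousLinearMap.id ℝ ℝ))
  refine ⟨z, Prod.ext (ext_inner_right ℝ fun a => ?_) (Prod.ext hx ?_)⟩
  · rw [reduceVec, inner_covectorGrad, hα]
    simp
  · rw [reduceVec, hα]
    simp

end Reduction

section PoissonMap

open VectorField

/-- The vector in the moving frame dual to the `(m, p)` part of a covector on `ℝ³ × ℝ × ℝ`. -/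
def momentumPart (a : V →L[ℝ] ℝ) : E3 × ℝ := (covectorGrad a, a (0, 0, 1))

theorem covector_apply_coord (a : V →L[ℝ] ℝ) (v : V) :
    a v = ⟪covectorGrad a, v.1⟫_ℝ + (v.2.1 * a (0, 1, 0) + v.2.2 * a (0, 0, 1)) := by
  rw [covector_apply, ← smul_eq_mul, ← smul_eq_mul, ← map_smul, ← map_smul, ← map_add]
  simp

theorem comp_reduceVec (a : V →L[ℝ] ℝ) : a ∘ reduceVec = fun z =>
    momentumFun (bodyField (momentumPart a)) z + a (0, 1, 0) * angleQ z.proj := by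
  funext z
  change a (reduceVec z) = bodyCovector z (momentumPart a) + _
  rw [bodyCovector_eq_reduceVec, covector_apply_coord, real_inner_comm]
  simp only [momentumPart, reduceVec]
  ring

theorem momentumFun_mlieBracket_bodyField (w w' : E3 × ℝ) (z : TStarQ) :
    momentumFun (mlieBracket modelQ (bodyField w) (bodyField w')) z =
      ⟪(reduceVec z).1, cross w.1 w'.1⟫_ℝ := by
  have h := bodyCovector_eq_reduceVec z (cross w.1 w'.1, 0)
  rw [zero_mul, add_zero] at h
  exact (congrArg (modelCovector z) (mlieBracket_bodyField w w' z.proj)).trans h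

theorem hasMFDerivAt_const_mul_angleQ (c : ℝ) (x : Q) :
    HasMFDerivAt modelQ 𝓘(ℝ, ℝ) (fun y => c * angleQ y) x (c • angleDifferential x) :=
  (hasMFDerivAt_angleQ x).const_smul c

theorem canonicalBracket_comp_reduceVec (a b : V →L[ℝ] ℝ) (z : TStarQ) :
    canonicalBracket modelQ (a ∘ reduceVec) (b ∘ reduceVec) z =
      a (reducedTensor (reduceVec z) b) := by
  rw [comp_reduceVec, comp_reduceVec, canonicalBracket_momentumFun_add_comp_proj
    (mdiffAt_bodyField _ _) (mdiffAt_bodyField _ _) (hasMFDerivAt_const_mul_angleQ _ _)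
    (hasMFDerivAt_const_mul_angleQ _ _), momentumFun_mlieBracket_bodyField, apply_reducedTensor]
  have hangle (c : ℝ) (w : E3 × ℝ) :
      (c • angleDifferential z.proj) (bodyTangent z.proj w) = c * w.2 :=
    congrArg (c * ·) (angleDifferential_bodyTangent z.proj w)
  exact congrArg (_ + ·) (congrArg₂ (· - ·) (hangle _ _) (hangle _ _))

theorem hasMFDerivAt_reduceVec (z : TStarQ) :
    HasMFDerivAt modelTStarQ 𝓘(ℝ, V) reduceVec z (mfderiv modelTStarQ 𝓘(ℝ, V) reduceVec z) :=
  (contMDiff_reduceVec.mdifferentiable (by simp) z).hasMFDerivAt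

theorem canonicalBracket_comp_reduceVec_of_hasFDerivAt {f h : V → ℝ} {a b : V →L[ℝ] ℝ} {z : TStarQ}
    (hf : HasFDerivAt f a (reduceVec z)) (hh : HasFDerivAt h b (reduceVec z)) :
    canonicalBracket modelQ (f ∘ reduceVec) (h ∘ reduceVec) z =
      a (reducedTensor (reduceVec z) b) := by
  rw [← canonicalBracket_comp_reduceVec]
  have hlin {f : V → ℝ} {a : V →L[ℝ] ℝ} (hf : HasFDerivAt f a (reduceVec z)) :
      mfderiv modelTStarQ 𝓘(ℝ, ℝ) (f ∘ reduceVec) z =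
        mfderiv modelTStarQ 𝓘(ℝ, ℝ) (a ∘ reduceVec) z :=
    (hf.hasMFDerivAt.comp z (hasMFDerivAt_reduceVec z)).mfderiv.trans
      (a.hasMFDerivAt.comp z (hasMFDerivAt_reduceVec z)).mfderiv.symm
  exact canonicalBracket_congr (hlin hf) (hlin hh)

end PoissonMap

section OpenMaps

open Filter Topology

variable {E : Type*} [NormedAddCommGroup E] [NormedSpace ℝ E] [CompleteSpace E]
  {H : Type*} [TopologicalSpace H] {I : ModelWithCorners ℝ E H} [I.Boundaryless]
  {M : Type*} [TopologicalSpace M] [ChartedSpace H M]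
  {E' : Type*} [NormedAddCommGroup E'] [NormedSpace ℝ E'] [CompleteSpace E']
  {H' : Type*} [TopologicalSpace H'] {I' : ModelWithCorners ℝ E' H'}
  {M' : Type*} [TopologicalSpace M'] [ChartedSpace H' M']

theorem map_writtenInExtChartAt_nhds {φ : M → M'} {x : M} {L : E →L[ℝ] E'}
    (hφ : ContMDiffAt I I' ∞ φ x) (hL : HasMFDerivAt I I' φ x L) (hsurj : Surjective L) :
    map (writtenInExtChartAt I I' x φ) (𝓝 (extChartAt I x x)) =
      𝓝 (extChartAt I' (φ x) (φ x)) := by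
  have hsmooth := (contMDiffAt_iff.1 hφ).2
  have hderiv := hL.2
  rw [I.range_eq_univ] at hsmooth hderiv
  have hL' : HasFDerivAt (writtenInExtChartAt I I' x φ) L (extChartAt I x x) :=
    hasFDerivWithinAt_univ.1 hderiv
  have hstrict := (contDiffWithinAt_univ.1 hsmooth).hasStrictFDerivAt (by simp)
  have h := hstrict.map_nhds_eq_of_surj (LinearMap.range_eq_top.2 (hL'.fderiv ▸ hsurj))
  simpa using h

theorem IsSmoothSubmersion.isOpenMap [I'.Boundaryless] {φ : M → M'}
    (hφ : IsSmoothSubmersion I I' φ) : IsOpenMap φ := by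
  refine isOpenMap_iff_nhds_le.2 fun x => ge_of_eq ?_
  have hchart : φ =ᶠ[𝓝 x] (extChartAt I' (φ x)).symm ∘ writtenInExtChartAt I I' x φ ∘
      extChartAt I x := by
    filter_upwards [extChartAt_source_mem_nhds (I := I) x,
      hφ.1.continuous.continuousAt.preimage_mem_nhds
        (extChartAt_source_mem_nhds (I := I') (φ x))] with y hy hφy
    simp only [writtenInExtChartAt, Function.comp_apply, (extChartAt I x).left_inv hy]
    exact ((extChartAt I' (φ x)).left_inv hφy).symm
  rw [map_congr hchart, ← map_map, ← map_map, map_extChartAt_nhds_of_boundaryless,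
    map_writtenInExtChartAt_nhds (hφ.1 x) (hφ.1.mdifferentiable (by simp) x).hasMFDerivAt (hφ.2 x),
    ← nhdsWithin_univ, ← I'.range_eq_univ, map_extChartAt_symm_nhdsWithin_range]

end OpenMaps

section Submersion

theorem exists_hasMFDerivAt_momentumFun_bodyField (w : E3 × ℝ) (z : TStarQ) :
    ∃ l, HasMFDerivAt modelTStarQ 𝓘(ℝ, ℝ) (momentumFun (bodyField w)) z
      (phaseCovector l (bodyTangent z.proj w)) := by
  obtain ⟨x, α⟩ := z
  have h := hasMFDerivAt_momentumFun α
    (differentiableAt_chartField (mdiffAt_bodyField w x)).hasFDerivAt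
  rw [chartField_self] at h
  exact ⟨_, h⟩

/-- The differential of the reduction map, on model vector spaces. -/
def reduceDifferential (z : TStarQ) : ModelSpace × (ModelSpace →L[ℝ] ℝ) →L[ℝ] V :=
  mfderiv modelTStarQ 𝓘(ℝ, V) reduceVec z

theorem comp_reduceDifferential_eq {a : V →L[ℝ] ℝ} {z : TStarQ} {l : ModelSpace →L[ℝ] ℝ}
    (hl : HasMFDerivAt modelTStarQ 𝓘(ℝ, ℝ) (momentumFun (bodyField (momentumPart a))) z
      (phaseCovector l (bodyTangent z.proj (momentumPart a)))) :
    a ∘L reduceDifferential z = phaseCovector (l + a (0, 1, 0) • angleDifferential z.proj)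
      (bodyTangent z.proj (momentumPart a)) := by
  have h := hl.add (hasMFDerivAt_comp_proj (hasMFDerivAt_const_mul_angleQ (a (0, 1, 0)) z.proj))
  have h' := a.hasMFDerivAt.comp z (hasMFDerivAt_reduceVec z)
  rw [comp_reduceVec] at h'
  refine (hasMFDerivAt_unique h' h).trans ?_
  exact (phaseCovector_add _ _ _ _).trans (congrArg _ (add_zero _))

theorem hasMFDerivAt_momentumFun_bodyField_zero (z : TStarQ) :
    HasMFDerivAt modelTStarQ 𝓘(ℝ, ℝ) (momentumFun (bodyField 0)) z
      (0 : ModelSpace × (ModelSpace →L[ℝ] ℝ) →L[ℝ] ℝ) := by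
  have h : momentumFun (bodyField 0) = fun _ => (0 : ℝ) :=
    funext fun z => (bodyCovector z).map_zero
  rw [h]
  exact hasMFDerivAt_const _ _

theorem eq_zero_of_comp_reduceDifferential_eq_zero {a : V →L[ℝ] ℝ} {z : TStarQ}
    (h : a ∘L reduceDifferential z = 0) : a = 0 := by
  obtain ⟨l, hl⟩ := exists_hasMFDerivAt_momentumFun_bodyField (momentumPart a) z
  have hD := (comp_reduceDifferential_eq hl).symm.trans h
  have hmom : momentumPart a = 0 := by
    refine (bodyTangent z.proj).map_eq_zero_iff.1 ?_
    refine (SeparatingDual.eq_zero_iff_forall_dual_eq_zero (R := ℝ) _).2 fun η => ?_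
    have h0 := DFunLike.congr_fun hD (0, η)
    rwa [phaseCovector_apply, map_zero, zero_add] at h0
  have hangle : a (0, 1, 0) = 0 := by
    have h0 : HasMFDerivAt modelTStarQ 𝓘(ℝ, ℝ) (momentumFun (bodyField (momentumPart a))) z
        (phaseCovector 0 (bodyTangent z.proj (momentumPart a))) := by
      rw [hmom, map_zero, phaseCovector_zero]
      exact hasMFDerivAt_momentumFun_bodyField_zero z
    have hD := (comp_reduceDifferential_eq h0).symm.trans h
    have hB := DFunLike.congr_fun hD (bodyTangent z.proj (0, 1), 0)
    rw [phaseCovector_apply, zero_add] at hB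
    simpa [angleDifferential_bodyTangent] using hB
  refine ContinuousLinearMap.ext fun v => ?_
  have hgrad : covectorGrad a = 0 := (Prod.ext_iff.1 hmom).1
  have hp : a (0, 0, 1) = 0 := (Prod.ext_iff.1 hmom).2
  rw [covector_apply_coord, hgrad, hangle, hp, inner_zero_left, mul_zero, mul_zero, add_zero,
    add_zero, zero_apply]

theorem reduceDifferential_surjective (z : TStarQ) : Surjective (reduceDifferential z) := by
  refine LinearMap.dualMap_injective_iff.1 ((injective_iff_map_eq_zero _).2 fun a ha => ?_)
  have h := eq_zero_of_comp_reduceDifferential_eq_zero (a := a.toContinuousLinearMap) (z := z)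
    (ContinuousLinearMap.coe_injective ha)
  exact congrArg ContinuousLinearMap.toLinearMap h

end Submersion

section ReductionMap

/-- The reduction map `T*Q → ℝ³ × (0, π) × ℝ`, which assigns to a covector its angular momentum in
the moving frame, the angle of its base point and the momentum conjugate to the angle. -/
def reduceMap (z : TStarQ) : ReducedSpace := ⟨reduceVec z, angleQ_mem_Ioo z.proj⟩

theorem contMDiff_reduceMap : ContMDiff modelTStarQ 𝓘(ℝ, V) ∞ reduceMap :=
  (ContMDiff.subtypeVal_comp_iff _ _).1 contMDiff_reduceVec

theorem reduceMap_eq_iff {z z' : TStarQ} :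
    reduceMap z = reduceMap z' ↔ MulAction.orbitRel SO3 TStarQ z z' :=
  Subtype.ext_iff.trans reduceVec_eq_iff

theorem reduceMap_surjective : Surjective reduceMap := fun y =>
  (exists_reduceVec_eq y.2).imp fun _ hz => Subtype.ext hz

theorem isSmoothSubmersion_reduceMap : IsSmoothSubmersion modelTStarQ 𝓘(ℝ, V) reduceMap := by
  refine ⟨contMDiff_reduceMap, fun z => ?_⟩
  have h := (hasMFDerivAt_subtype_val (I := 𝓘(ℝ, V)) (reduceMap z)).comp z
    (contMDiff_reduceMap.mdifferentiable (by simp) z).hasMFDerivAt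
  have heq : mfderiv modelTStarQ 𝓘(ℝ, V) reduceMap z = reduceDifferential z := h.mfderiv.symm
  rw [heq]
  exact reduceDifferential_surjective z

theorem canonicalBracket_comp_reduceMap_of_hasFDerivAt {f h : ReducedSpace → ℝ} {F G : V → ℝ}
    {a b : V →L[ℝ] ℝ} {z : TStarQ} (hf : ∀ y, f y = F y.1) (hh : ∀ y, h y = G y.1)
    (hF : HasFDerivAt F a (reduceVec z)) (hG : HasFDerivAt G b (reduceVec z)) :
    canonicalBracket modelQ (f ∘ reduceMap) (h ∘ reduceMap) z =
      reducedBracket f h (reduceMap z) := by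
  obtain rfl := funext hf
  obtain rfl := funext hh
  refine (canonicalBracket_comp_reduceVec_of_hasFDerivAt hF hG).trans ?_
  rw [reducedBracket_eq_tensorBracket, tensorBracket, differential_comp_val (y := reduceMap z) hF,
    differential_comp_val (y := reduceMap z) hG]
  rfl

theorem canonicalBracket_comp_reduceMap {f h : ReducedSpace → ℝ} {G : V → ℝ}
    (hf : SmoothFun 𝓘(ℝ, V) f) (hh : ∀ y, h y = G y.1) {z : TStarQ}
    (hG : DifferentiableAt ℝ G (reduceVec z)) :
    canonicalBracket modelQ (f ∘ reduceMap) (h ∘ reduceMap) z =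
      reducedBracket f h (reduceMap z) :=
  canonicalBracket_comp_reduceMap_of_hasFDerivAt (fun y => (extendFun_val f y).symm) hh
    ((contDiffAt_extendFun hf (reduceMap z)).differentiableAt (by simp)).hasFDerivAt
    hG.hasFDerivAt

theorem isPoissonMap_reduceMap :
    IsPoissonMap modelTStarQ 𝓘(ℝ, V) (canonicalBracket modelQ) reducedBracket reduceMap :=
  ⟨contMDiff_reduceMap, fun _ _ hf hh z => canonicalBracket_comp_reduceMap hf
    (fun y => (extendFun_val _ y).symm)
    ((contDiffAt_extendFun hh (reduceMap z)).differentiableAt (by simp))⟩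

end ReductionMap

section QuotientHomeomorph

variable {X Y : Type*} [TopologicalSpace X] [TopologicalSpace Y]

/-- The homeomorphism `X / s ≃ Y` induced by a quotient map `f : X → Y` whose fibres are the classes
of `s`. -/
def quotientHomeomorph {s : Setoid X} {f : X → Y} (hf : Topology.IsQuotientMap f)
    (hs : ∀ x x', f x = f x' ↔ s x x') : Quotient s ≃ₜ Y :=
  (Equiv.ofBijective (Quotient.lift f fun x x' => (hs x x').2)
    ⟨Quotient.ind₂ fun x x' h => Quotient.sound ((hs x x').1 h),
      Quotient.lift_surjective f _ hf.surjective⟩).toHomeomorph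
    fun _ => isQuotientMap_quotient_mk'.isOpen_preimage.symm.trans hf.isOpen_preimage

end QuotientHomeomorph

section HomeomorphToOpens

open Topology

variable {𝕜 : Type*} [NontriviallyNormedField 𝕜] {E : Type*} [NormedAddCommGroup E]
  [NormedSpace 𝕜 E] {H : Type*} [TopologicalSpace H] {I : ModelWithCorners 𝕜 E H}
  {X : Type*} [TopologicalSpace X] {U : TopologicalSpace.Opens H}

theorem isOpenEmbedding_val_comp_homeomorph (Φ : X ≃ₜ U) : IsOpenEmbedding (Subtype.val ∘ Φ) :=
  U.isOpen.isOpenEmbedding_subtypeVal.comp Φ.isOpenEmbedding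

variable [Nonempty X]

/-- The charted space with the single chart given by a homeomorphism `Φ` onto an open subset of the
model space. -/
@[reducible] def homeomorphChartedSpace (Φ : X ≃ₜ U) : ChartedSpace H X :=
  (isOpenEmbedding_val_comp_homeomorph Φ).singletonChartedSpace

/-- A homeomorphism `Φ` onto an open subset of the model space is a diffeomorphism for the smooth
structure that it defines. -/
def homeomorphDiffeomorph (Φ : X ≃ₜ U) :
    letI := homeomorphChartedSpace Φ
    Diffeomorph I I X U ∞ :=
  letI := homeomorphChartedSpace Φ
  { Φ.toEquiv with
    contMDiff_toFun := (ContMDiff.subtypeVal_comp_iff _ _).1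
      (contMDiff_isOpenEmbedding (isOpenEmbedding_val_comp_homeomorph Φ))
    contMDiff_invFun := ContMDiff.of_comp_isOpenEmbedding (isOpenEmbedding_val_comp_homeomorph Φ)
      ((contMDiff_subtype_val (I := I) (U := U)).congr fun y =>
        congrArg Subtype.val (Φ.apply_symm_apply y)) }

end HomeomorphToOpens

section OrbitSpace

theorem isOpenMap_reduceMap : IsOpenMap reduceMap := isSmoothSubmersion_reduceMap.isOpenMap

/-- The homeomorphism between the orbit space and the reduced space induced by `reduceMap`. -/
def orbitHomeomorph : OrbitSpace ≃ₜ ReducedSpace :=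
  quotientHomeomorph (isOpenMap_reduceMap.isQuotientMap contMDiff_reduceMap.continuous
    reduceMap_surjective) fun _ _ => reduceMap_eq_iff

instance : Nonempty OrbitSpace :=
  let ⟨x, _⟩ := exists_angleQ_eq ⟨half_pos Real.pi_pos, half_lt_self Real.pi_pos⟩
  ⟨orbitProj ⟨x, 0⟩⟩

/-- The smooth structure of the orbit space: the reduced coordinates form a global chart. -/
@[reducible] def orbitChartedSpace : ChartedSpace V OrbitSpace :=
  homeomorphChartedSpace orbitHomeomorph

attribute [local instance] orbitChartedSpace

theorem isManifold_orbitSpace : IsManifold 𝓘(ℝ, V) ∞ OrbitSpace :=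
  (isOpenEmbedding_val_comp_homeomorph orbitHomeomorph).isManifold_singleton

/-- The diffeomorphism between the orbit space and the reduced space induced by `reduceMap`. -/
def orbitDiffeomorph : Diffeomorph 𝓘(ℝ, V) 𝓘(ℝ, V) OrbitSpace ReducedSpace ∞ :=
  homeomorphDiffeomorph orbitHomeomorph

/-- The Poisson bracket of the orbit space. -/
def orbitBracket : (OrbitSpace → ℝ) → (OrbitSpace → ℝ) → OrbitSpace → ℝ :=
  pullbackBracket orbitDiffeomorph reducedBracket

theorem orbitDiffeomorph_symm_comp_reduceMap : orbitDiffeomorph.symm ∘ reduceMap = orbitProj :=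
  funext fun z => orbitDiffeomorph.symm_apply_apply (orbitProj z)

theorem isPoissonBracket_orbitBracket : IsPoissonBracket 𝓘(ℝ, V) orbitBracket :=
  isPoissonBracket_reducedBracket.pullback orbitDiffeomorph

theorem isSmoothSubmersion_orbitProj : IsSmoothSubmersion modelTStarQ 𝓘(ℝ, V) orbitProj :=
  orbitDiffeomorph_symm_comp_reduceMap ▸
    isSmoothSubmersion_reduceMap.diffeomorph_comp orbitDiffeomorph.symm

theorem isPoissonMap_orbitProj :
    IsPoissonMap modelTStarQ 𝓘(ℝ, V) (canonicalBracket modelQ) orbitBracket orbitProj :=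
  orbitDiffeomorph_symm_comp_reduceMap ▸ isPoissonMap_reduceMap.symm_comp orbitDiffeomorph

theorem isPoissonMap_orbitDiffeomorph :
    IsPoissonMap 𝓘(ℝ, V) 𝓘(ℝ, V) orbitBracket reducedBracket orbitDiffeomorph :=
  isPoissonMap_pullbackBracket orbitDiffeomorph

end OrbitSpace

section ReductionMapCharacterization

theorem bodyVelocity_rot_inv (x : Q) (ξ : E3) :
    bodyVelocity x (rot (frameRotation x)⁻¹ ξ, 0) = (cross ξ (R₁ x), cross ξ (R₂ x)) := by
  have hξ : rot (frameRotation x) (rot (frameRotation x)⁻¹ ξ) = ξ := by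
    rw [← rot_mul, mul_inv_cancel, rot_one]
  rw [bodyVelocity_apply, zero_smul, add_zero, rot_cross, rot_cross, hξ, ← R₁_eq_rot, ← R₂_eq_rot]

theorem rot_inv_frameRotation_apply (x : Q) (ξ : E3) (i : Fin 3) :
    rot (frameRotation x)⁻¹ ξ i = ⟪bodyFrame x i, ξ⟫_ℝ := by
  have hξ : rot (frameRotation x) (rot (frameRotation x)⁻¹ ξ) = ξ := by
    rw [← rot_mul, mul_inv_cancel, rot_one]
  conv_rhs => rw [← rot_frameRotation_single, ← hξ, inner_rot]
  simp [EuclideanSpace.inner_single_left]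

theorem bodyVelocity_zero_one (x : Q) : bodyVelocity x (0, 1) =
    (0, Real.cos (angleQ x) • bodyFrame x 1 - Real.sin (angleQ x) • bodyFrame x 2) := by
  simp [bodyVelocity_apply, cross, meridianDeriv, ← rot_frameRotation_single, rot]

theorem apply_eq_bodyCovector (z : TStarQ) {v : TangentSpace modelQ z.proj} {w : E3 × ℝ}
    (h : velocity z.proj v = bodyVelocity z.proj w) : (z.2 v : ℝ) = bodyCovector z w := by
  obtain rfl : v = bodyTangent z.proj w :=
    velocityModel_injective z.proj (h.trans (velocityModel_bodyTangent z.proj w).symm)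
  rfl

theorem apply_eq_sum_mCoord_reduceMap (z : TStarQ) (ξ : E3) (v : TangentSpace modelQ z.proj)
    (hv : velocity z.proj v = (cross ξ (R₁ z.proj), cross ξ (R₂ z.proj))) :
    (z.2 v : ℝ) = ∑ i, mCoord i (reduceMap z) * ⟪bodyFrame z.proj i, ξ⟫_ℝ := by
  rw [apply_eq_bodyCovector z (hv.trans (bodyVelocity_rot_inv z.proj ξ).symm),
    bodyCovector_eq_reduceVec, zero_mul, add_zero, inner_eq_sum, Fin.sum_univ_three]
  simp only [rot_inv_frameRotation_apply]
  rfl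

theorem apply_eq_pCoord_reduceMap (z : TStarQ) (v : TangentSpace modelQ z.proj)
    (hv : velocity z.proj v = (0, Real.cos (angleQ z.proj) • bodyFrame z.proj 1
      - Real.sin (angleQ z.proj) • bodyFrame z.proj 2)) :
    (z.2 v : ℝ) = pCoord (reduceMap z) :=
  apply_eq_bodyCovector z (hv.trans (bodyVelocity_zero_one z.proj).symm)

end ReductionMapCharacterization

section LegendreTransform

variable {μ₁ μ₂ : ℝ}

/-- The bilinear form of twice the kinetic energy at a configuration with angle `q`, in the
components of `bodyVelocity`. -/
def kineticForm (μ₁ μ₂ q : ℝ) (w w' : E3 × ℝ) : ℝ :=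
  μ₁ * (w.1 0 * w'.1 0 + w.1 1 * w'.1 1) +
    μ₂ * ((w.1 1 * Real.cos q - w.1 2 * Real.sin q) * (w'.1 1 * Real.cos q - w'.1 2 * Real.sin q) +
      (w.2 - w.1 0) * (w'.2 - w'.1 0))

theorem inner_bodyVelocity_fst (x : Q) (w w' : E3 × ℝ) :
    ⟪(bodyVelocity x w).1, (bodyVelocity x w').1⟫_ℝ = w.1 0 * w'.1 0 + w.1 1 * w'.1 1 := by
  have hcomp (a : E3) : cross a (EuclideanSpace.single 2 1) = !₂[a 1, -a 0, 0] := by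
    ext i
    fin_cases i <;> simp [cross_apply_zero, cross_apply_one, cross_apply_two]
  rw [bodyVelocity_apply, bodyVelocity_apply, inner_rot, hcomp, hcomp, inner_eq_sum]
  simp only [Matrix.cons_val]
  ring

theorem inner_bodyVelocity_snd (x : Q) (w w' : E3 × ℝ) :
    ⟪(bodyVelocity x w).2, (bodyVelocity x w').2⟫_ℝ =
      (w.1 1 * Real.cos (angleQ x) - w.1 2 * Real.sin (angleQ x)) *
        (w'.1 1 * Real.cos (angleQ x) - w'.1 2 * Real.sin (angleQ x)) +
      (w.2 - w.1 0) * (w'.2 - w'.1 0) := by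
  have hcomp (a : E3 × ℝ) : cross a.1 (meridian (angleQ x)) + a.2 • meridianDeriv (angleQ x) =
      !₂[a.1 1 * Real.cos (angleQ x) - a.1 2 * Real.sin (angleQ x),
        (a.2 - a.1 0) * Real.cos (angleQ x), -((a.2 - a.1 0) * Real.sin (angleQ x))] := by
    ext i
    fin_cases i <;>
      simp [cross_apply_zero, cross_apply_one, cross_apply_two, meridian, meridianDeriv] <;> ring
  rw [bodyVelocity_apply, bodyVelocity_apply, inner_rot, hcomp, hcomp, inner_eq_sum]
  simp only [Matrix.cons_val]
  linear_combination (w.2 - w.1 0) * (w'.2 - w'.1 0) * Real.sin_sq_add_cos_sq (angleQ x)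

theorem kineticForm_eq_inner_bodyVelocity (μ₁ μ₂ : ℝ) (x : Q) (w w' : E3 × ℝ) :
    kineticForm μ₁ μ₂ (angleQ x) w w' =
      μ₁ * ⟪(bodyVelocity x w).1, (bodyVelocity x w').1⟫_ℝ +
        μ₂ * ⟪(bodyVelocity x w).2, (bodyVelocity x w').2⟫_ℝ := by
  rw [inner_bodyVelocity_fst, inner_bodyVelocity_snd, kineticForm]

/-- The components of the velocity whose momentum has the reduced coordinates `v`. -/
def legendreInverse (μ₁ μ₂ : ℝ) (v : V) : E3 × ℝ :=
  let a₀ := (v.1 0 + v.2.2) / μ₁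
  let a₁ := (v.1 1 + Real.cos v.2.1 * v.1 2 / Real.sin v.2.1) / μ₁
  let a₂ := (a₁ * Real.cos v.2.1 + v.1 2 / (μ₂ * Real.sin v.2.1)) / Real.sin v.2.1
  (!₂[a₀, a₁, a₂], a₀ + v.2.2 / μ₂)

theorem kineticForm_legendreInverse (h₁ : μ₁ ≠ 0) (h₂ : μ₂ ≠ 0) {v : V}
    (hv : Real.sin v.2.1 ≠ 0) (w : E3 × ℝ) :
    kineticForm μ₁ μ₂ v.2.1 (legendreInverse μ₁ μ₂ v) w = ⟪v.1, w.1⟫_ℝ + w.2 * v.2.2 := by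
  rw [kineticForm, inner_eq_sum]
  simp only [legendreInverse, Matrix.cons_val, add_sub_cancel_left]
  field_simp
  ring

/-- The extension of `reducedHamiltonian` to `ℝ³ × ℝ × ℝ`; where `sin q = 0` the quotients take the
value `0`. -/
def reducedHamiltonianVec (μ₁ μ₂ : ℝ) (U : ℝ → ℝ) (v : V) : ℝ :=
  1 / (2 * μ₁) * (v.1 0 ^ 2 + v.1 1 ^ 2 + 2 * (Real.cos v.2.1 / Real.sin v.2.1) * v.1 1 * v.1 2 +
    (μ₁ / μ₂ + Real.cos v.2.1 ^ 2) / Real.sin v.2.1 ^ 2 * v.1 2 ^ 2 +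
    2 * v.1 0 * v.2.2 + (1 + μ₁ / μ₂) * v.2.2 ^ 2) + U v.2.1

theorem dotProduct_matA_mulVec (μ q : ℝ) (m : Fin 3 → ℝ) : m ⬝ᵥ (matA μ q *ᵥ m) =
    m 0 ^ 2 + m 1 ^ 2 + 2 * (Real.cos q / Real.sin q) * m 1 * m 2 +
      (μ + Real.cos q ^ 2) / Real.sin q ^ 2 * m 2 ^ 2 := by
  simp only [matA, dotProduct, Matrix.cons_mulVec, Fin.sum_univ_three, Matrix.cons_val]
  ring

theorem reducedHamiltonian_eq_reducedHamiltonianVec (μ₁ μ₂ : ℝ) (U : ℝ → ℝ) (y : ReducedSpace) :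
    reducedHamiltonian μ₁ μ₂ U y = reducedHamiltonianVec μ₁ μ₂ U y.1 := by
  rw [reducedHamiltonian, dotProduct_matA_mulVec, reducedHamiltonianVec]

theorem kineticForm_legendreInverse_self (h₁ : μ₁ ≠ 0) (h₂ : μ₂ ≠ 0) {v : V}
    (hv : Real.sin v.2.1 ≠ 0) :
    kineticForm μ₁ μ₂ v.2.1 (legendreInverse μ₁ μ₂ v) (legendreInverse μ₁ μ₂ v) / 2 =
      reducedHamiltonianVec μ₁ μ₂ 0 v := by
  rw [kineticForm_legendreInverse h₁ h₂ hv, inner_eq_sum]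
  simp only [legendreInverse, reducedHamiltonianVec, Matrix.cons_val, Pi.zero_apply, add_zero]
  field_simp
  ring

theorem differentiableAt_reducedHamiltonianVec (μ₁ μ₂ : ℝ) {U : ℝ → ℝ} {v : V}
    (hU : DifferentiableAt ℝ U v.2.1) (hv : Real.sin v.2.1 ≠ 0) :
    DifferentiableAt ℝ (reducedHamiltonianVec μ₁ μ₂ U) v := by
  unfold reducedHamiltonianVec
  have hv' : Real.sin v.2.1 ^ 2 ≠ 0 := pow_ne_zero 2 hv
  fun_prop (disch := assumption)

end LegendreTransform

section Hamiltonian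

variable {μ₁ μ₂ : ℝ}

theorem isMomentumOf_bodyTangent (h₁ : μ₁ ≠ 0) (h₂ : μ₂ ≠ 0) (z : TStarQ) :
    IsMomentumOf μ₁ μ₂ z.proj z.2 (bodyTangent z.proj (legendreInverse μ₁ μ₂ (reduceVec z))) := by
  intro w
  obtain ⟨w, rfl⟩ := (bodyTangent z.proj).surjective w
  have h := kineticForm_legendreInverse (v := reduceVec z) h₁ h₂ (sin_angleQ_pos z.proj).ne' w
  rw [← bodyCovector_eq_reduceVec] at h
  refine h.symm.trans ((kineticForm_eq_inner_bodyVelocity μ₁ μ₂ z.proj _ _).trans ?_)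
  rw [← velocityModel_bodyTangent, ← velocityModel_bodyTangent]
  rfl

theorem cotangentKineticEnergy_eq_reducedHamiltonianVec (h₁ : 0 < μ₁) (h₂ : 0 < μ₂) (z : TStarQ) :
    cotangentKineticEnergy μ₁ μ₂ z = reducedHamiltonianVec μ₁ μ₂ 0 (reduceVec z) := by
  have henergy := kineticForm_legendreInverse_self (v := reduceVec z) h₁.ne' h₂.ne'
    (sin_angleQ_pos z.proj).ne'
  have hform := kineticForm_eq_inner_bodyVelocity μ₁ μ₂ z.proj
    (legendreInverse μ₁ μ₂ (reduceVec z)) (legendreInverse μ₁ μ₂ (reduceVec z))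
  rw [← velocityModel_bodyTangent, real_inner_self_eq_norm_sq, real_inner_self_eq_norm_sq] at hform
  exact (cotangentKineticEnergy_eq h₁ h₂ z _ (isMomentumOf_bodyTangent h₁.ne' h₂.ne' z)).trans
    ((congrArg (· / 2) hform).symm.trans henergy)

theorem hamiltonian_eq_reducedHamiltonian (h₁ : 0 < μ₁) (h₂ : 0 < μ₂) (U : ℝ → ℝ) (z : TStarQ) :
    hamiltonian μ₁ μ₂ U z = reducedHamiltonian μ₁ μ₂ U (reduceMap z) := by
  rw [hamiltonian, cotangentKineticEnergy_eq_reducedHamiltonianVec h₁ h₂,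
    reducedHamiltonian_eq_reducedHamiltonianVec, reducedHamiltonianVec, reducedHamiltonianVec,
    Pi.zero_apply, add_zero]
  rfl

theorem canonicalBracket_comp_reduceMap_hamiltonian (h₁ : 0 < μ₁) (h₂ : 0 < μ₂) {U : ℝ → ℝ}
    (hU : DifferentiableOn ℝ U (Ioo 0 Real.pi)) {f : ReducedSpace → ℝ}
    (hf : SmoothFun 𝓘(ℝ, V) f) (z : TStarQ) :
    canonicalBracket modelQ (f ∘ reduceMap) (hamiltonian μ₁ μ₂ U) z =
      reducedBracket f (reducedHamiltonian μ₁ μ₂ U) (reduceMap z) := by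
  rw [funext (hamiltonian_eq_reducedHamiltonian h₁ h₂ U)]
  exact canonicalBracket_comp_reduceMap hf (reducedHamiltonian_eq_reducedHamiltonianVec μ₁ μ₂ U)
    (differentiableAt_reducedHamiltonianVec μ₁ μ₂
      (hU.differentiableAt (isOpen_Ioo.mem_nhds (angleQ_mem_Ioo z.proj)))
      (sin_angleQ_pos z.proj).ne')

end Hamiltonian

end TwoBody

end

theorem mainTheorem7 :
    -- the reduced bracket is a Poisson structure, given by the stated relations, with Casimir `|m|²`
    (IsPoissonBracket 𝓘(ℝ, V) reducedBracket ∧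
      reducedBracket (mCoord 0) (mCoord 1) = -mCoord 2 ∧
      reducedBracket (mCoord 1) (mCoord 2) = -mCoord 0 ∧
      reducedBracket (mCoord 2) (mCoord 0) = -mCoord 1 ∧
      reducedBracket qCoord pCoord = 1 ∧
      (∀ i, reducedBracket (mCoord i) qCoord = 0 ∧ reducedBracket (mCoord i) pCoord = 0) ∧
      IsCasimir 𝓘(ℝ, V) reducedBracket (fun y => ‖y.1.1‖ ^ 2)) ∧
    -- `T*Q / SO(3)` is a manifold and carries a Poisson bracket that makes the projection a
    -- Poisson submersion
    ∃ (_ : ChartedSpace V OrbitSpace) (br : (OrbitSpace → ℝ) → (OrbitSpace → ℝ) → OrbitSpace → ℝ),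
      IsManifold 𝓘(ℝ, V) ∞ OrbitSpace ∧
      IsSmoothSubmersion modelTStarQ 𝓘(ℝ, V) orbitProj ∧
      IsPoissonBracket 𝓘(ℝ, V) br ∧
      IsPoissonMap modelTStarQ 𝓘(ℝ, V) (canonicalBracket modelQ) br orbitProj ∧
      -- a Poisson isomorphism `Ψ` to `ℝ³ × (0, π) × ℝ`
      ∃ Ψ : Diffeomorph 𝓘(ℝ, V) 𝓘(ℝ, V) OrbitSpace ReducedSpace ∞,
        IsPoissonMap 𝓘(ℝ, V) 𝓘(ℝ, V) br reducedBracket Ψ ∧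
        -- `q` is the angle, `m` the angular momentum in the moving frame, `p` conjugate to `q`
        (∀ z : TStarQ, qCoord (Ψ (orbitProj z)) = angleQ z.proj) ∧
        (∀ (z : TStarQ) (ξ : E3) (v : TangentSpace modelQ z.proj),
          velocity z.proj v = (cross ξ (R₁ z.proj), cross ξ (R₂ z.proj)) →
          (z.2 v : ℝ) = ∑ i, mCoord i (Ψ (orbitProj z)) * ⟪bodyFrame z.proj i, ξ⟫_ℝ) ∧
        (∀ (z : TStarQ) (v : TangentSpace modelQ z.proj),
          velocity z.proj v = (0, Real.cos (angleQ z.proj) • bodyFrame z.proj 1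
            - Real.sin (angleQ z.proj) • bodyFrame z.proj 2) →
          (z.2 v : ℝ) = pCoord (Ψ (orbitProj z))) ∧
        -- the Hamiltonian and the dynamics reduce to those of the reduced Hamiltonian
        ∀ (μ₁ μ₂ : ℝ), 0 < μ₁ → 0 < μ₂ → ∀ U : ℝ → ℝ,
          (∀ z, hamiltonian μ₁ μ₂ U z = reducedHamiltonian μ₁ μ₂ U (Ψ (orbitProj z))) ∧
          (DifferentiableOn ℝ U (Set.Ioo 0 Real.pi) →
            (∀ f, SmoothFun 𝓘(ℝ, V) f → ∀ z,
              canonicalBracket modelQ (f ∘ Ψ ∘ orbitProj) (hamiltonian μ₁ μ₂ U) z =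
                reducedBracket f (reducedHamiltonian μ₁ μ₂ U) (Ψ (orbitProj z))) ∧
            ∀ (J : Set ℝ) (γ : ℝ → TStarQ),
              IsHamiltonianTrajectory modelTStarQ (canonicalBracket modelQ)
                (hamiltonian μ₁ μ₂ U) J γ →
              IsHamiltonianTrajectory 𝓘(ℝ, V) reducedBracket
                (reducedHamiltonian μ₁ μ₂ U) J (fun t => Ψ (orbitProj (γ t)))) := by
  refine ⟨⟨isPoissonBracket_reducedBracket, ?_⟩, orbitChartedSpace, orbitBracket,
    isManifold_orbitSpace, isSmoothSubmersion_orbitProj, isPoissonBracket_orbitBracket,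
    isPoissonMap_orbitProj, orbitDiffeomorph, isPoissonMap_orbitDiffeomorph, fun _ => rfl,
    apply_eq_sum_mCoord_reduceMap, apply_eq_pCoord_reduceMap, fun μ₁ μ₂ h₁ h₂ U =>
    ⟨hamiltonian_eq_reducedHamiltonian h₁ h₂ U, fun hU => ?_⟩⟩
  · obtain ⟨hxy, hyz, hzx, hqp, hm⟩ := reducedBracket_coordinates
    exact ⟨hxy, hyz, hzx, hqp, hm, isCasimir_norm_sq⟩
  · have reduces : ∀ f, SmoothFun 𝓘(ℝ, V) f → ∀ z,
        canonicalBracket modelQ (f ∘ reduceMap) (hamiltonian μ₁ μ₂ U) z =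
          reducedBracket f (reducedHamiltonian μ₁ μ₂ U) (reduceMap z) := fun f hf =>
      canonicalBracket_comp_reduceMap_hamiltonian h₁ h₂ hU hf
    exact ⟨reduces, fun J γ hγ => IsHamiltonianTrajectory.map contMDiff_reduceMap reduces hγ⟩
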